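/- Let $\alpha\in(0,1/2)$, $0<\gamma<\alpha$, $d\in\mathbb N$, and let $\Pi^+=\{\Im z>0\}$, $\bar\Pi^+=\{\Im z\ge 0\}$. For $k\ge 0$ and $z\in\Pi^+$ put $$f_k(z)=2^{\alpha-1}\Big[\frac{\alpha(1-2\alpha)(2-2\alpha)_k}{2\cos(\pi\alpha)\,k!}\Big]^{1/2}\Big[\frac{z+\imath}{2\imath}\Big]^{2\alpha-2}\Big[\frac{z-\imath}{z+\imath}\Big]^k ,$$ where $(x)_k=\prod_{j=0}^{k-1}(x+j)$. On a probability space $(\mathcal U,\mathcal F,\mathbf P)$ let $\xi_k(i)=(\xi^1_k(i)+\imath\,\xi^2_k(i))/\sqrt2$ ($k\ge0$, $1\le i\le d$), where all the $\xi^1_k(i),\xi^2_k(i)$ are independent real standard Gaussian variables. The $d$-dimensional analytic fractional Brownian motion $\Gamma=(\Gamma(1),\dots,\Gamma(d))$ with Hurst parameter $\alpha$ is given by $\Gamma'_z(i)=\sum_{k\ge0}f_k(z)\xi_k(i)$ and $\Gamma_z(i)=\int_{[0,z]}\Gamma'_u(i)\,du$ for $z\in\Pi^+$, and by $\Gamma_t=\lim_{y\downarrow0}\Gamma_{t+\imath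 y}$ for $t\in\mathbb R$ (the limit exists almost surely). For $\varepsilon>0$ and $s,t\in\bar\Pi^+$ set $\Gamma^\varepsilon_t=\Gamma_{t+\imath\varepsilon}$ and $$\mathbf\Gamma^{\mathbf 2,\varepsilon}_{ts}(i,j)=\int_{[s,t]}d\Gamma^\varepsilon_{u_1}(i)\int_{[s,u_1]}d\Gamma^\varepsilon_{u_2}(j),\qquad 1\le i,j\le d,$$ where $d\Gamma^\varepsilon_u=\Gamma'_{u+\imath\varepsilon}\,du$ and $[s,t]$ is the oriented segment from $s$ to $t$. For $\Omega\subset\bar\Pi^+$, $\mathcal C_1^\gamma(\Omega;V)$ is the space of $g:\Omega\to V$ with finite norm $\sup_{t}|g_t|+\sup_{s,t}|g_t-g_s|/|t-s|^{\gamma}$; $\mathcal C_2^{\mu}(\Omega;V)$ is the space of $h:\Omega^2\to V$ vanishing on the diagonal with finite norm $\sup_{s,t}|h_{ts}|/|t-s|^\mu$; and $\mathcal C_2^{\mathrm m,\beta}(\Omega;V)$ is the space of $h$, defined on $\bar\Pi^+\times\bar\Pi^+$ and vanishing on the diagonal of $\Omega^2$, such that $\sup\{|h_{t+\imath\varepsilon,s+\imath\varepsilon}-h_{ts}|/\varepsilon^{\beta}:\varepsilon\in(0,1],\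 s,t\in\Omega\}<\infty$. Write $(\delta g)_{ts}=g_t-g_s$ and $(\delta h)_{tus}=h_{ts}-h_{tu}-h_{us}$. Then there is a random function $\mathbf\Gamma^{\mathbf 2}$ on $\bar\Pi^+\times\bar\Pi^+$ with values in $\mathbb C^{d,d}$ (the Lévy area) such that for every bounded neighbourhood $\Omega$ of $0$ in $\bar\Pi^+$: 1. for every real $p\ge1$, the couple $(\Gamma^\varepsilon,\mathbf\Gamma^{\mathbf 2,\varepsilon})$ converges, as $\varepsilon\downarrow0$, to $(\Gamma,\mathbf\Gamma^{\mathbf 2})$ in $L^p\big(\mathcal U;\mathcal C_1^\gamma(\Omega;\mathbb C^d)\times\mathcal C_2^{2\gamma}(\Omega;\mathbb C^{d,d})\big)$; 2. almost surely, $\mathbf\Gamma^{\mathbf 2}\in\mathcal C_2^{2\gamma}(\Omega;\mathbb C^{d,d})\cap\mathcal C_2^{\mathrm m,\gamma}(\Omega;\mathbb C^{d,d})$; 3. almost surely, for all $i,j\in\{1,\dots,d\}$ and all $s,t,u\in\Omega$, $$(\delta\mathbf\Gamma^{\mathbf 2}(i,j))_{tus}=(\delta\Gamma(i))_{tu}\,(\delta\Gamma(j))_{us},\qquad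 \mathbf\Gamma^{\mathbf 2}_{ts}(i,j)+\mathbf\Gamma^{\mathbf 2}_{ts}(j,i)=(\delta\Gamma(i))_{ts}\,(\delta\Gamma(j))_{ts}.$$ -/

import Mathlib

open MeasureTheory ProbabilityTheory Filter Topology
open scoped ENNReal

namespace AnalyticFBM

noncomputable section

/-- The closed upper half-plane. -/
def closedUHP : Set ℂ := {z | 0 ≤ z.im}

/-- The integral of `f` along the oriented segment from `s` to `t`. -/
def segIntegral (f : ℂ → ℂ) (s t : ℂ) : ℂ :=
  (t - s) * ∫ r in (0 : ℝ)..1, f (s + (r : ℂ) * (t - s))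

/-- The analytic functions `f_k` on the upper half-plane, with parameter `α`;
`(ascPochhammer ℝ k).eval (2 - 2 * α)` is the Pochhammer symbol `(2 - 2α)_k`,
and complex powers use the principal branch. -/
def basisFun (α : ℝ) (k : ℕ) (z : ℂ) : ℂ :=
  ((2 : ℝ) ^ (α - 1) *
      Real.sqrt (α * (1 - 2 * α) * (ascPochhammer ℝ k).eval (2 - 2 * α) /
        (2 * Real.cos (Real.pi * α) * (k.factorial : ℝ))) : ℝ) *
    ((z + Complex.I) / (2 * Complex.I)) ^ ((2 * α - 2 : ℝ) : ℂ) *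
    ((z - Complex.I) / (z + Complex.I)) ^ k

variable {U : Type*} {d : ℕ}

/-- The complex random variables `ξ_k(i) = (ξ¹_k(i) + 𝐢 ξ²_k(i)) / √2`. If all real variables are
independent and standard Gaussian, then `E |ξ_k(i)|² = 1` and `E ξ_k(i)² = 0`. -/
def complexGaussian (ξ : Fin d × ℕ × Fin 2 → U → ℝ) (i : Fin d) (k : ℕ) (ω : U) : ℂ :=
  ((ξ (i, k, 0) ω : ℂ) + Complex.I * (ξ (i, k, 1) ω : ℂ)) / (Real.sqrt 2 : ℂ)

/-- The process `Γ'_z(i) = ∑_k f_k(z) ξ_k(i)`, for `z` in the open upper half-plane. -/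
def gammaDeriv (α : ℝ) (ξ : Fin d × ℕ × Fin 2 → U → ℝ) (ω : U) (z : ℂ) (i : Fin d) : ℂ :=
  ∑' k : ℕ, basisFun α k z * complexGaussian ξ i k ω

/-- The analytic fractional Brownian motion `Γ` on the closed upper half-plane: for `Im z > 0`,
`Γ_z` is the integral of `Γ'` along the segment from `0` to `z`, and for real `t`, `Γ_t` is the
limit of `Γ_{t + 𝐢 y}` as `y` decreases to `0`. (Values at `Im z < 0` are never used.) -/
def gamma (α : ℝ) (ξ : Fin d × ℕ × Fin 2 → U → ℝ) (ω : U) (z : ℂ) (i : Fin d) : ℂ :=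
  if 0 < z.im then segIntegral (fun u => gammaDeriv α ξ ω u i) 0 z
  else limUnder (𝓝[>] (0 : ℝ)) fun y : ℝ =>
    segIntegral (fun u => gammaDeriv α ξ ω u i) 0 (z + Complex.I * (y : ℂ))

/-- The approximation `Γ^ε_z = Γ_{z + 𝐢 ε}`. -/
def gammaApprox (α : ℝ) (ξ : Fin d × ℕ × Fin 2 → U → ℝ) (ε : ℝ) (ω : U) (z : ℂ) : Fin d → ℂ :=
  gamma α ξ ω (z + Complex.I * (ε : ℂ))

/-- The regularized Lévy area
`Γ^{2,ε}_{ts}(i,j) = ∫_{[s,t]} dΓ^ε_{u₁}(i) ∫_{[s,u₁]} dΓ^ε_{u₂}(j)`,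
where `dΓ^ε_u = Γ'_{u + 𝐢 ε} du`. -/
def levyApprox (α : ℝ) (ξ : Fin d × ℕ × Fin 2 → U → ℝ) (ε : ℝ) (ω : U) (t s : ℂ) :
    Fin d → Fin d → ℂ := fun i j =>
  segIntegral (fun u₁ => gammaDeriv α ξ ω (u₁ + Complex.I * (ε : ℂ)) i *
    segIntegral (fun u₂ => gammaDeriv α ξ ω (u₂ + Complex.I * (ε : ℂ)) j) s u₁) s t

section Increments

variable {V : Type*} [NormedAddCommGroup V]

/-- `(δg)_{ts} = g_t - g_s`. -/
def delta₁ (g : ℂ → V) (t s : ℂ) : V := g t - g s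

/-- `(δh)_{tus} = h_{ts} - h_{tu} - h_{us}`. -/
def delta₂ (h : ℂ → ℂ → V) (t u s : ℂ) : V := h t s - h t u - h u s

/-- The Hölder norm of a 1-increment, `sup_{s,t ∈ Ω} |h_{ts}| / |t - s|^μ`, with values in `[0,∞]`.
In `[0,∞]` we have `0 / 0 = 0` and `x / 0 = ∞` for `x ≠ 0`, so for `μ > 0` a finite norm forces
`h_{tt} = 0`. -/
def holderNorm₂ (μ : ℝ) (Ω : Set ℂ) (h : ℂ → ℂ → V) : ℝ≥0∞ :=
  ⨆ t ∈ Ω, ⨆ s ∈ Ω, ‖h t s‖ₑ / ‖t - s‖ₑ ^ μ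

/-- The full Hölder norm of a path: its sup norm plus the Hölder seminorm. -/
def holderNorm₁ (μ : ℝ) (Ω : Set ℂ) (g : ℂ → V) : ℝ≥0∞ :=
  (⨆ t ∈ Ω, ‖g t‖ₑ) + holderNorm₂ μ Ω (delta₁ g)

/-- The multiparametric seminorm
`sup {|h_{t+𝐢ε, s+𝐢ε} - h_{ts}| / ε^β : ε ∈ [0,1], s, t ∈ Ω}`, where `0 / 0 = 0`. -/
def multiNorm₂ (β : ℝ) (Ω : Set ℂ) (h : ℂ → ℂ → V) : ℝ≥0∞ :=
  ⨆ ε ∈ Set.Icc (0 : ℝ) 1, ⨆ t ∈ Ω, ⨆ s ∈ Ω,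
    ‖h (t + Complex.I * (ε : ℂ)) (s + Complex.I * (ε : ℂ)) - h t s‖ₑ / ENNReal.ofReal ε ^ β

/-- Membership in `𝒞₂^μ(Ω; V)`: increments vanishing on the diagonal with finite Hölder norm. -/
def MemHolder₂ (μ : ℝ) (Ω : Set ℂ) (h : ℂ → ℂ → V) : Prop :=
  (∀ t ∈ Ω, h t t = 0) ∧ holderNorm₂ μ Ω h < ∞

/-- Membership in `𝒞₂^{m,β}(Ω; V)`. -/
def MemMulti₂ (β : ℝ) (Ω : Set ℂ) (h : ℂ → ℂ → V) : Prop :=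
  (∀ t ∈ Ω, h t t = 0) ∧ multiNorm₂ β Ω h < ∞

end Increments

/-- The norm of a couple in `𝒞₁^γ(Ω; ℂ^d) × 𝒞₂^{2γ}(Ω; ℂ^{d,d})`. -/
def pairNorm (γ : ℝ) (Ω : Set ℂ) (g : ℂ → Fin d → ℂ) (h : ℂ → ℂ → Fin d → Fin d → ℂ) : ℝ≥0∞ :=
  holderNorm₁ γ Ω g + holderNorm₂ (2 * γ) Ω h

/-- The random couple `(X, A)` belongs to `L^p(U; 𝒞₁^γ(Ω; ℂ^d) × 𝒞₂^{2γ}(Ω; ℂ^{d,d}))`. -/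
structure InLp [MeasurableSpace U] (P : Measure U) (p γ : ℝ) (Ω : Set ℂ)
    (X : U → ℂ → Fin d → ℂ) (A : U → ℂ → ℂ → Fin d → Fin d → ℂ) : Prop where
  aemeasurable_path : ∀ t ∈ Ω, AEMeasurable (fun ω => X ω t) P
  aemeasurable_area : ∀ t ∈ Ω, ∀ s ∈ Ω, AEMeasurable (fun ω => A ω t s) P
  aemeasurable_norm : AEMeasurable (fun ω => pairNorm γ Ω (X ω) (A ω)) P
  lintegral_lt_top : ∫⁻ ω, pairNorm γ Ω (X ω) (A ω) ^ p ∂P < ∞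

/-- `(X^ε, A^ε) → (X, A)` in `L^p(U; 𝒞₁^γ(Ω; ℂ^d) × 𝒞₂^{2γ}(Ω; ℂ^{d,d}))` as `ε` decreases to `0`,
all couples `(X^ε, A^ε)`, `ε > 0`, and the limit being elements of that space. -/
structure ConvergesInLp [MeasurableSpace U] (P : Measure U) (p γ : ℝ) (Ω : Set ℂ)
    (Xε : ℝ → U → ℂ → Fin d → ℂ) (Aε : ℝ → U → ℂ → ℂ → Fin d → Fin d → ℂ)
    (X : U → ℂ → Fin d → ℂ) (A : U → ℂ → ℂ → Fin d → Fin d → ℂ) : Prop where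
  approx_mem : ∀ ε : ℝ, 0 < ε → InLp P p γ Ω (Xε ε) (Aε ε)
  limit_mem : InLp P p γ Ω X A
  sub_mem : ∀ ε : ℝ, 0 < ε → InLp P p γ Ω (Xε ε - X) (Aε ε - A)
  tendsto : Tendsto (fun ε : ℝ => ∫⁻ ω, pairNorm γ Ω ((Xε ε - X) ω) ((Aε ε - A) ω) ^ p ∂P)
    (𝓝[>] 0) (𝓝 0)

end

end AnalyticFBM

/-!
The proof is pathwise once the growth of `Γ'` at the real axis is known.

Almost surely `Γ'` is holomorphic in the upper half-plane, and for every `β < α` and every half-disc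
`|Γ'_z| ≤ N (Im z)^{β-1}` with a random constant `N` having as many moments as desired
(`exists_growthBound`).
Indeed `∑ₖ |fₖ(z)|² = C (Im z)^{2α-2}` by the binomial series, so that a Gaussian moment bound
gives `E |Γ'_z|^{2m} ≤ C_m (Im z)^{(2α-2)m}`. The mean value inequality for the holomorphic function
`(Γ')^{2m}` on the disc of centre `z` and radius `Im z / 2` bounds `((Im z)^{1-β} |Γ'_z|)^{2m}` by a
weighted Bergman integral of `|Γ'|^{2m}`, whose expectation is finite for `m` large.

Everything else holds for each holomorphic `F` with such a growth bound. An integral from `w` to `z`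
of a function that is `O(K (Im u)^{β-1})` may be taken along the detour through `w + 𝐢 h` and
`z + 𝐢 h`, where `h = |z - w|`, and is `O(K h^β)` (`norm_sub_le_of_detour`). This shows that `Γ` is
`β`-Hölder up to the boundary. Applied to `u ↦ Γ'_u(i) (Γ_u(j) - Γ_w(j))`, for which
`K = O(N² h^β)`, it bounds the area between `w` and `z` by `N² h^{2β}` (`norm_area_le_of_openUHP`),
however small `α` is: this is where analyticity replaces cancellations.

Let `H` be a primitive of `Γ'(i) Γ(j)`. The area from `s` to `t` is
`H_t - H_s - (Γ_t(i) - Γ_s(i)) Γ_s(j)`, which is continuous up to the boundary, and the regularized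
area is the same expression at `t + 𝐢 ε`, `s + 𝐢 ε`. Hence the limit exists, the multiplicative
relation is an algebraic identity, the shuffle relation follows from `(Γ(i) Γ(j))'` being the sum of
`Γ'(i) Γ(j)` and `Γ'(j) Γ(i)`, and the difference between the regularized and the
limiting area is `O(N² |t - s|^{2β})` as well as `O(N² ε^β)`. Interpolation gives
`O(N² |t - s|^{2γ} ε^{β-γ})` for `γ < β`, and the moments of `N` yield the convergence in `L^p`.
-/

namespace AnalyticFBM

/-! ### Growth bounds, Hölder estimates and boundary values in the half-plane -/

/-- `F` grows at most like `N (Im z)^{β-1}` on the half-disc of radius `R` above the real axis. -/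
def GrowthBound (β R N : ℝ) (F : ℂ → ℂ) : Prop :=
  ∀ z : ℂ, 0 < z.im → ‖z‖ ≤ R → ‖F z‖ ≤ N * z.im ^ (β - 1)

/-- Integration of `K (Im u)^{β-1}` along a vertical segment of height `h`; by subadditivity of
`v ↦ v^β` the bound does not depend on the starting height. -/
theorem norm_sub_le_of_vertical {β K h : ℝ} (hβ : 0 < β) (hβ1 : β ≤ 1) (hh : 0 ≤ h) (hK : 0 ≤ K)
    {f φ : ℂ → ℂ} {w : ℂ} (hw : 0 < w.im)
    (hf : ∀ u : ℂ, 0 < u.im → HasDerivAt f (φ u) u)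
    (hφ : ∀ v ∈ Set.Icc 0 h, ‖φ (w + v * Complex.I)‖ ≤ K * (w.im + v) ^ (β - 1)) :
    ‖f (w + h * Complex.I) - f w‖ ≤ K / β * h ^ β := by
  have him : ∀ v : ℝ, (w + v * Complex.I).im = w.im + v := fun v => by simp
  have hd : ∀ v ∈ Set.Icc 0 h, HasDerivAt (fun v : ℝ => f (w + v * Complex.I) - f w)
      (φ (w + v * Complex.I) * Complex.I) v := by
    intro v hv
    have h1 : HasDerivAt (fun v : ℝ => w + v * Complex.I) Complex.I v := by
      simpa using ((Complex.ofRealCLM.hasDerivAt (x := v)).mul_const Complex.I).const_add w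
    have h2 := hf (w + v * Complex.I) (by rw [him]; linarith [hv.1])
    exact (h2.comp v h1).sub_const _
  have hB : ∀ v ∈ Set.Icc 0 h, HasDerivAt (fun v : ℝ => K / β * ((w.im + v) ^ β - w.im ^ β))
      (K * (w.im + v) ^ (β - 1)) v := by
    intro v hv
    have h1 : HasDerivAt (fun v : ℝ => w.im + v) 1 v := by
      simpa using (hasDerivAt_id v).const_add w.im
    have h2 := (h1.rpow_const (p := β) (Or.inl (by linarith [hv.1]))).sub_const (w.im ^ β)
    refine (h2.const_mul (K / β)).congr_deriv ?_
    rw [one_mul, ← mul_assoc, div_mul_cancel₀ K hβ.ne']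
  have key := image_norm_le_of_norm_deriv_right_le_deriv_boundary' (a := 0) (b := h)
    (fun v hv => (hd v hv).continuousAt.continuousWithinAt)
    (fun v hv => (hd v ⟨hv.1, hv.2.le⟩).hasDerivWithinAt)
    (B := fun v : ℝ => K / β * ((w.im + v) ^ β - w.im ^ β)) (by simp)
    (fun v hv => (hB v hv).continuousAt.continuousWithinAt)
    (fun v hv => (hB v ⟨hv.1, hv.2.le⟩).hasDerivWithinAt)
    (fun v hv => by simpa using hφ v ⟨hv.1, hv.2.le⟩)
    (Set.right_mem_Icc.2 hh)
  refine key.trans ?_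
  gcongr
  have := Real.rpow_add_le_add_rpow hw.le hh hβ.le hβ1
  linarith

/-- A Hardy–Littlewood estimate: the segment from `w` to `z` is replaced by the detour through
`w + 𝐢 h` and `z + 𝐢 h`, where `h = |z - w|`, along which `(Im u)^{β-1}` is integrable with
integral `O(h^β)`. -/
theorem norm_sub_le_of_detour {β K : ℝ} (hβ : 0 < β) (hβ1 : β ≤ 1) (hK : 0 ≤ K)
    {f φ : ℂ → ℂ} {z w : ℂ} (hz : 0 < z.im) (hw : 0 < w.im)
    (hf : ∀ u : ℂ, 0 < u.im → HasDerivAt f (φ u) u)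
    (hφ : ∀ u : ℂ, 0 < u.im → ‖u - w‖ ≤ 2 * ‖z - w‖ → ‖φ u‖ ≤ K * u.im ^ (β - 1)) :
    ‖f z - f w‖ ≤ (2 / β + 1) * K * ‖z - w‖ ^ β := by
  rcases eq_or_ne z w with rfl | hne
  · simp; positivity
  set h := ‖z - w‖ with hh
  have h0 : 0 < h := norm_pos_iff.2 (sub_ne_zero.2 hne)
  have him : ∀ (x : ℂ) (v : ℝ), (x + v * Complex.I).im = x.im + v := fun x v => by simp
  have hnI : ∀ v : ℝ, 0 ≤ v → ‖(v : ℂ) * Complex.I‖ = v := fun v hv => by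
    simp [abs_of_nonneg hv]
  have e1 := norm_sub_le_of_vertical hβ hβ1 h0.le hK hw hf (fun v hv => by
    rw [← him]
    apply hφ _ (by rw [him]; linarith [hv.1])
    rw [add_sub_cancel_left, hnI v hv.1]; linarith [hv.2])
  have e2 := norm_sub_le_of_vertical hβ hβ1 h0.le hK hz hf (fun v hv => by
    rw [← him]
    apply hφ _ (by rw [him]; linarith [hv.1])
    have : z + v * Complex.I - w = (z - w) + v * Complex.I := by ring
    rw [this]
    refine (norm_add_le _ _).trans ?_
    rw [hnI v hv.1]; linarith [hv.2])
  -- On the horizontal part of the detour the imaginary part is at least `h`.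
  have hseg : ∀ u ∈ segment ℝ (w + h * Complex.I) (z + h * Complex.I),
      h ≤ u.im ∧ ‖u - w‖ ≤ 2 * h := by
    rintro u ⟨a, b, ha, hb, hab, rfl⟩
    constructor
    · simp
      nlinarith [mul_nonneg ha hw.le, mul_nonneg hb hz.le]
    · have : a • (w + h * Complex.I) + b • (z + h * Complex.I) - w
          = (b : ℂ) * (z - w) + h * Complex.I := by
        have : (a : ℂ) = 1 - b := by rw [eq_sub_iff_add_eq]; exact_mod_cast hab
        simp only [Complex.real_smul, this]; ring
      rw [this]
      refine (norm_add_le _ _).trans ?_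
      rw [hnI h h0.le, norm_mul, Complex.norm_real, Real.norm_of_nonneg hb, ← hh]
      nlinarith
  have e3 : ‖f (z + h * Complex.I) - f (w + h * Complex.I)‖
      ≤ K * h ^ (β - 1) * ‖(z + h * Complex.I) - (w + h * Complex.I)‖ := by
    refine Convex.norm_image_sub_le_of_norm_hasDerivWithin_le (f' := φ)
      (fun u hu => (hf u (h0.trans_le (hseg u hu).1)).hasDerivWithinAt) (fun u hu => ?_)
      (convex_segment _ _) (left_mem_segment _ _ _) (right_mem_segment _ _ _)
    refine (hφ u (h0.trans_le (hseg u hu).1) (hseg u hu).2).trans ?_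
    gcongr K * ?_
    exact Real.rpow_le_rpow_of_nonpos h0 (hseg u hu).1 (by linarith)
  rw [add_sub_add_right_eq_sub, ← hh, mul_assoc] at e3
  have : h ^ (β - 1) * h = h ^ β := by
    rw [← Real.rpow_add_one h0.ne']; congr 1; ring
  rw [this] at e3
  calc ‖f z - f w‖ = ‖-(f (z + h * Complex.I) - f z)
        + (f (z + h * Complex.I) - f (w + h * Complex.I)) + (f (w + h * Complex.I) - f w)‖ := by
        congr 1; ring
    _ ≤ K / β * h ^ β + K * h ^ β + K / β * h ^ β := by
        refine (norm_add₃_le).trans ?_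
        rw [norm_neg]; gcongr
    _ = _ := by field_simp; ring

/-- The open upper half-plane. -/
def openUHP : Set ℂ := {z | 0 < z.im}

theorem isOpen_openUHP : IsOpen openUHP := isOpen_lt continuous_const Complex.continuous_im

theorem convex_openUHP : Convex ℝ openUHP := convex_halfSpace_im_gt 0

theorem add_mem_openUHP {z : ℂ} (hz : z ∈ closedUHP) {ε : ℝ} (hε : 0 < ε) :
    z + Complex.I * ε ∈ openUHP := by
  have : 0 ≤ z.im := hz
  change 0 < (z + Complex.I * ε).im
  simp; linarith

theorem add_mem_closedUHP {z : ℂ} (hz : z ∈ closedUHP) {ε : ℝ} (hε : 0 ≤ ε) :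
    z + Complex.I * ε ∈ closedUHP := by
  have : 0 ≤ z.im := hz
  change 0 ≤ (z + Complex.I * ε).im
  simp; linarith

theorem tendsto_add_vertical (z : ℂ) :
    Tendsto (fun ε : ℝ => z + Complex.I * ε) (𝓝[>] 0) (𝓝 z) := by
  have : Continuous (fun ε : ℝ => z + Complex.I * ε) := by fun_prop
  have := this.tendsto 0
  simp only [Complex.ofReal_zero, mul_zero, add_zero] at this
  exact this.mono_left nhdsWithin_le_nhds

theorem tendsto_nhdsWithin_add_vertical {z : ℂ} (hz : z ∈ closedUHP) :
    Tendsto (fun ε : ℝ => z + Complex.I * ε) (𝓝[>] 0) (𝓝[openUHP] z) :=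
  tendsto_nhdsWithin_iff.2 ⟨tendsto_add_vertical z, by
    filter_upwards [self_mem_nhdsWithin] with ε hε using add_mem_openUHP hz hε⟩

theorem openUHP_subset_closedUHP : openUHP ⊆ closedUHP := fun z (hz : 0 < z.im) => hz.le

theorem closedUHP_subset_closure : closedUHP ⊆ closure openUHP := fun z hz =>
  mem_closure_of_tendsto (tendsto_add_vertical z) (by
    filter_upwards [self_mem_nhdsWithin] with ε hε using add_mem_openUHP hz hε)

theorem tendsto_comp_vertical {V : Type*} [TopologicalSpace V] {f : ℂ → V}
    (hf : ContinuousOn f closedUHP) {z : ℂ} (hz : z ∈ closedUHP) :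
    Tendsto (fun ε : ℝ => f (z + Complex.I * ε)) (𝓝[>] 0) (𝓝 (f z)) :=
  (hf z hz).tendsto.comp ((tendsto_nhdsWithin_add_vertical hz).mono_right
    (nhdsWithin_mono _ openUHP_subset_closedUHP))

/-- A function on the open half-plane which is Hölder continuous on all half-discs extends
continuously to the closed half-plane. -/
theorem exists_continuousOn_extension {β : ℝ} (hβ : 0 < β) {f : ℂ → ℂ}
    (hf : ∀ r : ℝ, ∃ C : ℝ, ∀ z ∈ openUHP, ∀ w ∈ openUHP, ‖z‖ ≤ r → ‖w‖ ≤ r →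
      ‖f z - f w‖ ≤ C * ‖z - w‖ ^ β) :
    ∃ g : ℂ → ℂ, Set.EqOn g f openUHP ∧ ContinuousOn g closedUHP := by
  have hlim : ∀ x ∈ closedUHP, ∃ y, Tendsto f (𝓝[openUHP] x) (𝓝 y) := by
    intro x hx
    obtain ⟨C, hC⟩ := hf (‖x‖ + 1)
    have hne : (𝓝[openUHP] x).NeBot :=
      mem_closure_iff_nhdsWithin_neBot.1 (closedUHP_subset_closure hx)
    rw [← cauchy_map_iff_exists_tendsto, cauchy_map_iff]
    refine ⟨hne, ?_⟩
    rw [Metric.uniformity_eq_comap_nhds_zero, tendsto_comap_iff]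
    have hfst : Tendsto (fun p : ℂ × ℂ => p.1) (𝓝[openUHP] x ×ˢ 𝓝[openUHP] x) (𝓝 x) :=
      tendsto_fst.mono_right nhdsWithin_le_nhds
    have hsnd : Tendsto (fun p : ℂ × ℂ => p.2) (𝓝[openUHP] x ×ˢ 𝓝[openUHP] x) (𝓝 x) :=
      tendsto_snd.mono_right nhdsWithin_le_nhds
    have hb : Tendsto (fun p : ℂ × ℂ => C * ‖p.1 - p.2‖ ^ β)
        (𝓝[openUHP] x ×ˢ 𝓝[openUHP] x) (𝓝 0) := by
      have h1 := (hfst.sub hsnd).norm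
      rw [sub_self, norm_zero] at h1
      have h2 := (h1.rpow_const (p := β) (Or.inr hβ.le)).const_mul C
      rwa [Real.zero_rpow hβ.ne', mul_zero] at h2
    have hball : ∀ᶠ z in 𝓝[openUHP] x, z ∈ openUHP ∧ ‖z‖ ≤ ‖x‖ + 1 := by
      have : ∀ᶠ z in 𝓝 x, ‖z‖ < ‖x‖ + 1 :=
        (continuous_norm.tendsto x).eventually_lt_const (by linarith)
      filter_upwards [self_mem_nhdsWithin, nhdsWithin_le_nhds this] with z h1 h2 using ⟨h1, h2.le⟩
    refine squeeze_zero' (Eventually.of_forall fun _ => dist_nonneg) ?_ hb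
    filter_upwards [(hball.prod_mk hball)] with p hp
    simp only [Function.comp]
    rw [dist_eq_norm]
    exact hC _ hp.1.1 _ hp.2.1 hp.1.2 hp.2.2
  have hcont : ContinuousOn (extendFrom openUHP f) closedUHP :=
    continuousOn_extendFrom closedUHP_subset_closure hlim
  refine ⟨extendFrom openUHP f, fun z hz => ?_, hcont⟩
  have hfc : ContinuousOn f openUHP := by
    intro x hx
    obtain ⟨y, hy⟩ := hlim x (openUHP_subset_closedUHP hx)
    have hx' : 𝓝[openUHP] x = 𝓝 x := isOpen_openUHP.nhdsWithin_eq hx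
    have : f x = y := by
      rw [hx'] at hy
      exact tendsto_nhds_unique (tendsto_pure_nhds f x) (hy.mono_left (pure_le_nhds x))
    rw [ContinuousWithinAt, this]; exact hy
  exact extendFrom_extends hfc z hz

theorem exists_primitive {φ : ℂ → ℂ} (hφ : DifferentiableOn ℂ φ openUHP) :
    ∃ f : ℂ → ℂ, ∀ z ∈ openUHP, HasDerivAt f (φ z) z := by
  obtain ⟨f, hf⟩ := convex_openUHP.exists_forall_hasDerivWithinAt hφ
  exact ⟨f, fun z hz => (hf z hz).hasDerivAt (isOpen_openUHP.mem_nhds hz)⟩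

/-! ### Segment integrals, the path and the size of the area -/

theorem segIntegral_eq_sub {G f : ℂ → ℂ} {s t : ℂ}
    (hc : ContinuousOn (fun r : ℝ => G (s + r * (t - s))) (Set.Icc 0 1))
    (hd : ∀ r ∈ Set.Ioo (0 : ℝ) 1, HasDerivAt G (f (s + r * (t - s))) (s + r * (t - s)))
    (hi : IntervalIntegrable (fun r : ℝ => f (s + r * (t - s))) volume 0 1) :
    segIntegral f s t = G t - G s := by
  have h := intervalIntegral.integral_eq_sub_of_hasDerivAt_of_le zero_le_one hc
    (f' := fun r : ℝ => (t - s) * f (s + r * (t - s))) (fun r hr => by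
      have h1 : HasDerivAt (fun r : ℝ => s + r * (t - s)) (t - s) r := by
        simpa using ((Complex.ofRealCLM.hasDerivAt (x := r)).mul_const (t - s)).const_add s
      rw [mul_comm]
      exact (hd r hr).comp r h1) (hi.const_mul _)
  rw [segIntegral, ← intervalIntegral.integral_const_mul, h]
  simp

theorem segment_mem_openUHP {s t : ℂ} (hs : s ∈ openUHP) (ht : t ∈ openUHP) {r : ℝ}
    (hr : r ∈ Set.Icc (0 : ℝ) 1) : s + r * (t - s) ∈ openUHP := by
  have := convex_openUHP.add_smul_sub_mem hs ht hr
  simpa using this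

/-- The fundamental theorem of calculus along a segment in the open half-plane. -/
theorem segIntegral_eq_sub_of_mem {G f : ℂ → ℂ} {s t : ℂ} (hs : s ∈ openUHP) (ht : t ∈ openUHP)
    (hG : ∀ z ∈ openUHP, HasDerivAt G (f z) z) (hf : ContinuousOn f openUHP) :
    segIntegral f s t = G t - G s := by
  have hm : Set.MapsTo (fun r : ℝ => s + r * (t - s)) (Set.Icc 0 1) openUHP :=
    fun r hr => segment_mem_openUHP hs ht hr
  have hl : ContinuousOn (fun r : ℝ => s + r * (t - s)) (Set.Icc 0 1) := by fun_prop
  refine segIntegral_eq_sub ?_ (fun r hr => hG _ (hm ⟨hr.1.le, hr.2.le⟩)) ?_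
  · exact ContinuousOn.comp (fun z hz => (hG z hz).continuousAt.continuousWithinAt) hl hm
  · refine ContinuousOn.intervalIntegrable ?_
    rw [Set.uIcc_of_le zero_le_one]
    exact hf.comp hl hm

/-- The path `z ↦ ∫_{[0,z]} F`, extended to the real line by vertical limits (a junk value where
the limit does not exist); `gamma` is of this form with `F = Γ'(i)`. -/
noncomputable def pathOf (F : ℂ → ℂ) (z : ℂ) : ℂ :=
  if 0 < z.im then segIntegral F 0 z
  else limUnder (𝓝[>] (0 : ℝ)) fun y : ℝ => segIntegral F 0 (z + Complex.I * (y : ℂ))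

/-- A primitive of `F` on the open half-plane which is continuous on the closed half-plane and
vanishes at the origin. -/
structure IsPrimitive (F g : ℂ → ℂ) : Prop where
  hasDerivAt : ∀ z ∈ openUHP, HasDerivAt g (F z) z
  continuousOn : ContinuousOn g closedUHP
  zero : g 0 = 0

theorem GrowthBound.mono {β R R' N : ℝ} {F : ℂ → ℂ} (h : GrowthBound β R N F) (hR : R' ≤ R) :
    GrowthBound β R' N F := fun z hz hz' => h z hz (hz'.trans hR)

/-- The detours between points of norm at most `r` stay in the disc of radius `5 r`. The estimate of
the area uses detours twice, whence the radii `5 r` and `25 r` in the growth bounds; an additional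
`+ 1` leaves room for a vertical shift. -/
theorem norm_le_of_detour {r h : ℝ} {z w u : ℂ} (hz : ‖z‖ ≤ r) (hw : ‖w‖ ≤ r)
    (hh : h = ‖z - w‖) (hu : ‖u - w‖ ≤ 2 * h) : ‖u‖ ≤ 5 * r := by
  have h1 : ‖z - w‖ ≤ ‖z‖ + ‖w‖ := norm_sub_le z w
  have h2 : ‖u‖ ≤ ‖u - w‖ + ‖w‖ := by simpa using norm_add_le (u - w) w
  linarith

/-- Passage to the boundary in a Hölder estimate. -/
theorem norm_le_of_closedUHP {μ r C : ℝ} {k : ℂ → ℂ → ℂ}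
    (hk : ∀ t ∈ closedUHP, ∀ s ∈ closedUHP,
      Tendsto (fun ε : ℝ => k (t + Complex.I * ε) (s + Complex.I * ε)) (𝓝[>] 0) (𝓝 (k t s)))
    (h : ∀ z ∈ openUHP, ∀ w ∈ openUHP, ‖z‖ ≤ r + 1 → ‖w‖ ≤ r + 1 → ‖k z w‖ ≤ C * ‖z - w‖ ^ μ)
    {t s : ℂ} (ht : t ∈ closedUHP) (hs : s ∈ closedUHP) (htr : ‖t‖ ≤ r) (hsr : ‖s‖ ≤ r) :
    ‖k t s‖ ≤ C * ‖t - s‖ ^ μ := by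
  refine le_of_tendsto (hk t ht s hs).norm ?_
  filter_upwards [Ioo_mem_nhdsGT (zero_lt_one (α := ℝ))] with ε hε
  have hn : ∀ x : ℂ, ‖x‖ ≤ r → ‖x + Complex.I * ε‖ ≤ r + 1 := fun x hx => by
    refine (norm_add_le _ _).trans ?_
    have : ‖Complex.I * (ε : ℂ)‖ ≤ 1 := by simp [abs_of_pos hε.1, hε.2.le]
    linarith
  simpa using h _ (add_mem_openUHP ht hε.1) _ (add_mem_openUHP hs hε.1) (hn t htr) (hn s hsr)

section

variable {β : ℝ} (hβ : 0 < β) (hβ1 : β ≤ 1)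

include hβ hβ1

theorem norm_sub_le_of_growthBound {r N : ℝ} (hN : 0 ≤ N) {F f : ℂ → ℂ}
    (hF : GrowthBound β (5 * r) N F) (hf : ∀ z ∈ openUHP, HasDerivAt f (F z) z)
    {z w : ℂ} (hz : z ∈ openUHP) (hw : w ∈ openUHP) (hzr : ‖z‖ ≤ r) (hwr : ‖w‖ ≤ r) :
    ‖f z - f w‖ ≤ (2 / β + 1) * N * ‖z - w‖ ^ β :=
  norm_sub_le_of_detour hβ hβ1 hN hz hw hf fun u hu hu' =>
    hF u hu (norm_le_of_detour hzr hwr rfl hu')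

theorem IsPrimitive.norm_sub_le {F g : ℂ → ℂ} (hg : IsPrimitive F g) {r N : ℝ} (hN : 0 ≤ N)
    (hF : GrowthBound β (5 * (r + 1)) N F) {z w : ℂ} (hz : z ∈ closedUHP) (hw : w ∈ closedUHP)
    (hzr : ‖z‖ ≤ r) (hwr : ‖w‖ ≤ r) :
    ‖g z - g w‖ ≤ (2 / β + 1) * N * ‖z - w‖ ^ β :=
  norm_le_of_closedUHP (k := fun z w => g z - g w)
    (fun _ ht _ hs => (tendsto_comp_vertical hg.continuousOn ht).sub
      (tendsto_comp_vertical hg.continuousOn hs))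
    (fun _ hz _ hw => norm_sub_le_of_growthBound hβ hβ1 hN hF hg.hasDerivAt hz hw) hz hw hzr hwr

theorem IsPrimitive.norm_le {F g : ℂ → ℂ} (hg : IsPrimitive F g) {r N : ℝ} (hr : 0 ≤ r)
    (hN : 0 ≤ N) (hF : GrowthBound β (5 * (r + 1)) N F) {z : ℂ} (hz : z ∈ closedUHP)
    (hzr : ‖z‖ ≤ r) : ‖g z‖ ≤ (2 / β + 1) * N * r ^ β := by
  have h0 : (0 : ℂ) ∈ closedUHP := le_refl (0 : ℝ)
  have := hg.norm_sub_le hβ hβ1 hN hF hz h0 hzr (by simpa using hr)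
  rw [hg.zero, sub_zero, sub_zero] at this
  refine this.trans ?_
  gcongr

/-- The segment `[0,z]` starts on the boundary, where `F` may be singular: the integral is computed
with a primitive that is continuous up to the boundary, `(Im u)^{β-1}` being integrable. -/
theorem isPrimitive_pathOf {F : ℂ → ℂ} (hF : DifferentiableOn ℂ F openUHP)
    (hN : ∀ R, ∃ N, 0 ≤ N ∧ GrowthBound β R N F) : IsPrimitive F (pathOf F) := by
  obtain ⟨G₀, hG₀⟩ := exists_primitive hF
  obtain ⟨G, hGG₀, hGc⟩ := exists_continuousOn_extension hβ (f := G₀) (fun r => by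
    obtain ⟨N, hN0, hNb⟩ := hN (5 * r)
    exact ⟨_, fun z hz w hw hzr hwr =>
      norm_sub_le_of_growthBound hβ hβ1 hN0 hNb hG₀ hz hw hzr hwr⟩)
  have hG : ∀ z ∈ openUHP, HasDerivAt G (F z) z := fun z hz =>
    (hG₀ z hz).congr_of_eventuallyEq (hGG₀.eventuallyEq_of_mem (isOpen_openUHP.mem_nhds hz))
  have hseg : ∀ z ∈ openUHP, segIntegral F 0 z = G z - G 0 := by
    intro z hz
    have hz0 : 0 < z.im := hz
    have him : ∀ r : ℝ, (0 + r * (z - 0) : ℂ).im = r * z.im := fun r => by simp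
    have hl : Continuous (fun r : ℝ => (0 + r * (z - 0) : ℂ)) := by fun_prop
    have hmem : ∀ r : ℝ, 0 < r → (0 + r * (z - 0) : ℂ) ∈ openUHP := fun r hr => by
      change 0 < (0 + r * (z - 0) : ℂ).im
      rw [him]; positivity
    refine segIntegral_eq_sub ?_ (fun r hr => hG _ (hmem r hr.1)) ?_
    · refine hGc.comp hl.continuousOn fun r hr => ?_
      change 0 ≤ (0 + r * (z - 0) : ℂ).im
      rw [him]; exact mul_nonneg hr.1 hz0.le
    · obtain ⟨N, hN0, hNb⟩ := hN ‖z‖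
      have hint : IntervalIntegrable (fun r : ℝ => N * z.im ^ (β - 1) * r ^ (β - 1)) volume 0 1 :=
        (intervalIntegral.intervalIntegrable_rpow' (by linarith)).const_mul _
      refine hint.mono_fun ?_ ?_
      · rw [Set.uIoc_of_le zero_le_one]
        refine ContinuousOn.aestronglyMeasurable ?_ measurableSet_Ioc
        exact hF.continuousOn.comp hl.continuousOn fun r hr => hmem r hr.1
      · rw [Set.uIoc_of_le zero_le_one]
        filter_upwards [ae_restrict_mem measurableSet_Ioc] with r hr
        refine (hNb _ (hmem r hr.1) ?_).trans (le_of_eq ?_)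
        · rw [zero_add, sub_zero, norm_mul, Complex.norm_real, Real.norm_of_nonneg hr.1.le]
          exact mul_le_of_le_one_left (norm_nonneg _) hr.2
        · rw [him, Real.mul_rpow hr.1.le hz0.le, Real.norm_of_nonneg]
          · ring
          · have := hr.1.le
            positivity
  have hpath : Set.EqOn (pathOf F) (fun z => G z - G 0) closedUHP := by
    intro z hz
    by_cases h : 0 < z.im
    · rw [pathOf, if_pos h, hseg z h]
    · rw [pathOf, if_neg h]
      apply Tendsto.limUnder_eq
      refine ((tendsto_comp_vertical hGc hz).sub_const (G 0)).congr' ?_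
      filter_upwards [self_mem_nhdsWithin] with ε hε using (hseg _ (add_mem_openUHP hz hε)).symm
  refine ⟨fun z hz => ?_, (hGc.sub continuousOn_const).congr hpath, ?_⟩
  · exact ((hG z hz).sub_const _).congr_of_eventuallyEq
      ((hpath.mono openUHP_subset_closedUHP).eventuallyEq_of_mem (isOpen_openUHP.mem_nhds hz))
  · have h0 : (0 : ℂ) ∈ closedUHP := le_refl (0 : ℝ)
    rw [hpath h0]; simp

end

/-- The area `∫ F₁ (g₂ - g₂(s))` from `s` to `t`, expressed through a primitive `H` of `F₁ g₂`. -/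
def area (H g₁ g₂ : ℂ → ℂ) (t s : ℂ) : ℂ := H t - H s - (g₁ t - g₁ s) * g₂ s

theorem tendsto_area {H g₁ g₂ : ℂ → ℂ} (hH : ContinuousOn H closedUHP)
    (h₁ : ContinuousOn g₁ closedUHP) (h₂ : ContinuousOn g₂ closedUHP) {t s : ℂ}
    (ht : t ∈ closedUHP) (hs : s ∈ closedUHP) :
    Tendsto (fun ε : ℝ => area H g₁ g₂ (t + Complex.I * ε) (s + Complex.I * ε)) (𝓝[>] 0)
      (𝓝 (area H g₁ g₂ t s)) :=
  ((tendsto_comp_vertical hH ht).sub (tendsto_comp_vertical hH hs)).sub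
    (((tendsto_comp_vertical h₁ ht).sub (tendsto_comp_vertical h₁ hs)).mul
      (tendsto_comp_vertical h₂ hs))

section

variable {β : ℝ} (hβ : 0 < β) (hβ1 : β ≤ 1) {F₁ F₂ g₁ g₂ H : ℂ → ℂ}
  (h₁ : IsPrimitive F₁ g₁) (h₂ : IsPrimitive F₂ g₂)
  (hH : ∀ z ∈ openUHP, HasDerivAt H (F₁ z * g₂ z) z)

include hβ hβ1 h₁ h₂ hH

/-- Along the detour, `|F₁(u)| |g₂(u) - g₂(w)| ≲ N² |z - w|^β (Im u)^{β-1}`. -/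
theorem norm_area_le_of_openUHP {r N : ℝ} (hN : 0 ≤ N) (hr : 0 ≤ r)
    (hF₁ : GrowthBound β (25 * r) N F₁) (hF₂ : GrowthBound β (25 * r) N F₂) {z w : ℂ}
    (hz : z ∈ openUHP) (hw : w ∈ openUHP) (hzr : ‖z‖ ≤ r) (hwr : ‖w‖ ≤ r) :
    ‖area H g₁ g₂ z w‖ ≤ 2 * (2 / β + 1) ^ 2 * N ^ 2 * ‖z - w‖ ^ (2 * β) := by
  set c := 2 / β + 1 with hc
  have hc0 : 0 ≤ c := by positivity
  have hd : ∀ u ∈ openUHP,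
      HasDerivAt (fun u => area H g₁ g₂ u w) (F₁ u * (g₂ u - g₂ w)) u := by
    intro u hu
    have := ((hH u hu).sub_const (H w)).sub
      (((h₁.hasDerivAt u hu).sub_const (g₁ w)).mul_const (g₂ w))
    refine this.congr_deriv ?_
    ring
  have key := norm_sub_le_of_detour hβ hβ1 (K := 2 * c * N ^ 2 * ‖z - w‖ ^ β) (by positivity)
    hz hw hd (fun u hu hu' => by
      have hur := norm_le_of_detour hzr hwr rfl hu'
      have e1 := hF₁ u hu (by linarith)
      have e2 := norm_sub_le_of_growthBound hβ hβ1 hN (r := 5 * r) (hF₂.mono (by linarith))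
        h₂.hasDerivAt hu hw hur (by linarith)
      have e3 : ‖u - w‖ ^ β ≤ 2 * ‖z - w‖ ^ β := by
        calc ‖u - w‖ ^ β ≤ (2 * ‖z - w‖) ^ β := by gcongr
          _ = 2 ^ β * ‖z - w‖ ^ β := Real.mul_rpow (by norm_num) (norm_nonneg _)
          _ ≤ 2 ^ (1 : ℝ) * ‖z - w‖ ^ β := by gcongr; norm_num
          _ = _ := by rw [Real.rpow_one]
      have hui : 0 ≤ u.im := le_of_lt hu
      calc ‖F₁ u * (g₂ u - g₂ w)‖ ≤ (N * u.im ^ (β - 1)) * (c * N * (2 * ‖z - w‖ ^ β)) := by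
            rw [norm_mul]
            gcongr
            exact e2.trans (by gcongr)
        _ = _ := by ring)
  have h0 : area H g₁ g₂ w w = 0 := by simp [area]
  rw [h0, sub_zero] at key
  refine key.trans (le_of_eq ?_)
  rw [two_mul β, Real.rpow_add_of_nonneg (norm_nonneg _) hβ.le hβ.le]
  ring

end

/-! ### Continuity up to the boundary and algebraic relations of the area -/

section

variable {β : ℝ} (hβ : 0 < β) (hβ1 : β ≤ 1) {F₁ F₂ g₁ g₂ : ℂ → ℂ}
  (h₁ : IsPrimitive F₁ g₁) (h₂ : IsPrimitive F₂ g₂)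

include hβ hβ1 h₁ h₂

/-- The Hölder estimate for the primitive `H` of `F₁ g₂`, recovered from that of the area. -/
theorem norm_le_of_area {H : ℂ → ℂ} {r N : ℝ} (hN : 0 ≤ N) (hr : 0 ≤ r)
    (hF₁ : GrowthBound β (5 * (r + 1)) N F₁) (hF₂ : GrowthBound β (5 * (r + 1)) N F₂) {z w : ℂ}
    (hz : z ∈ closedUHP) (hw : w ∈ closedUHP) (hzr : ‖z‖ ≤ r) (hwr : ‖w‖ ≤ r)
    (hA : ‖area H g₁ g₂ z w‖ ≤ 2 * (2 / β + 1) ^ 2 * N ^ 2 * ‖z - w‖ ^ (2 * β)) :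
    ‖H z - H w‖ ≤ (2 / β + 1) ^ 2 * N ^ 2 * (2 * ‖z - w‖ ^ β + r ^ β) * ‖z - w‖ ^ β := by
  have e1 := h₁.norm_sub_le hβ hβ1 hN hF₁ hz hw hzr hwr
  have e2 := h₂.norm_le hβ hβ1 hr hN hF₂ hw hwr
  have : H z - H w = area H g₁ g₂ z w + (g₁ z - g₁ w) * g₂ w := by rw [area]; ring
  rw [this]
  refine (norm_add_le _ _).trans ?_
  rw [norm_mul]
  rw [two_mul β, Real.rpow_add_of_nonneg (norm_nonneg _) hβ.le hβ.le] at hA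
  calc _ ≤ 2 * (2 / β + 1) ^ 2 * N ^ 2 * (‖z - w‖ ^ β * ‖z - w‖ ^ β) +
      ((2 / β + 1) * N * ‖z - w‖ ^ β) * ((2 / β + 1) * N * r ^ β) := by gcongr
    _ = _ := by ring

/-- The product `F₁ g₂` has a primitive that is continuous up to the boundary. -/
theorem exists_primitive_mul (hF₁ : DifferentiableOn ℂ F₁ openUHP)
    (hN : ∀ R, ∃ N, 0 ≤ N ∧ GrowthBound β R N F₁ ∧ GrowthBound β R N F₂) :
    ∃ H : ℂ → ℂ, (∀ z ∈ openUHP, HasDerivAt H (F₁ z * g₂ z) z) ∧ ContinuousOn H closedUHP := by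
  obtain ⟨H₀, hH₀⟩ := exists_primitive (φ := fun z => F₁ z * g₂ z)
    (hF₁.mul fun z hz => (h₂.hasDerivAt z hz).differentiableAt.differentiableWithinAt)
  obtain ⟨H, hHH₀, hHc⟩ := exists_continuousOn_extension hβ (f := H₀) (fun r₀ => by
    set r := max r₀ 0
    have hr : 0 ≤ r := le_max_right _ _
    obtain ⟨N, hN0, hF₁, hF₂⟩ := hN (25 * (r + 1))
    refine ⟨(2 / β + 1) ^ 2 * N ^ 2 * (2 * (2 * r) ^ β + r ^ β), fun z hz w hw hzr hwr => ?_⟩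
    have hzr : ‖z‖ ≤ r := hzr.trans (le_max_left _ _)
    have hwr : ‖w‖ ≤ r := hwr.trans (le_max_left _ _)
    have hA := norm_area_le_of_openUHP hβ hβ1 h₁ h₂ hH₀ hN0 hr (hF₁.mono (by linarith))
      (hF₂.mono (by linarith)) hz hw hzr hwr
    have hzw : ‖z - w‖ ≤ 2 * r := (norm_sub_le _ _).trans (by linarith)
    refine (norm_le_of_area hβ hβ1 h₁ h₂ hN0 hr (hF₁.mono (by linarith)) (hF₂.mono (by linarith))
      (openUHP_subset_closedUHP hz) (openUHP_subset_closedUHP hw) hzr hwr hA).trans ?_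
    gcongr)
  exact ⟨H, fun z hz => ((hH₀ z hz).congr_of_eventuallyEq
    (hHH₀.eventuallyEq_of_mem (isOpen_openUHP.mem_nhds hz))).congr_deriv (by simp), hHc⟩

theorem norm_area_le {H : ℂ → ℂ} (hH : ∀ z ∈ openUHP, HasDerivAt H (F₁ z * g₂ z) z)
    (hHc : ContinuousOn H closedUHP) {r N : ℝ} (hN : 0 ≤ N) (hr : 0 ≤ r)
    (hF₁ : GrowthBound β (25 * (r + 1)) N F₁) (hF₂ : GrowthBound β (25 * (r + 1)) N F₂) {t s : ℂ}
    (ht : t ∈ closedUHP) (hs : s ∈ closedUHP) (htr : ‖t‖ ≤ r) (hsr : ‖s‖ ≤ r) :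
    ‖area H g₁ g₂ t s‖ ≤ 2 * (2 / β + 1) ^ 2 * N ^ 2 * ‖t - s‖ ^ (2 * β) :=
  norm_le_of_closedUHP
    (fun _ ht _ hs => tendsto_area hHc h₁.continuousOn h₂.continuousOn ht hs)
    (fun _ hz _ hw => norm_area_le_of_openUHP hβ hβ1 h₁ h₂ hH hN (by linarith) hF₁ hF₂ hz hw)
    ht hs htr hsr

/-- The area is Hölder continuous under a simultaneous displacement of both end points. -/
theorem norm_area_shift_sub_le {H : ℂ → ℂ} (hH : ∀ z ∈ openUHP, HasDerivAt H (F₁ z * g₂ z) z)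
    (hHc : ContinuousOn H closedUHP) {r N : ℝ} (hN : 0 ≤ N) (hr : 1 ≤ r)
    (hF₁ : GrowthBound β (25 * (r + 1)) N F₁) (hF₂ : GrowthBound β (25 * (r + 1)) N F₂)
    {t s t' s' : ℂ}
    (ht : t ∈ closedUHP) (hs : s ∈ closedUHP) (htr : ‖t‖ ≤ r) (hsr : ‖s‖ ≤ r)
    (ht' : t' ∈ closedUHP) (hs' : s' ∈ closedUHP) (htr' : ‖t'‖ ≤ r) (hsr' : ‖s'‖ ≤ r)
    {ε : ℝ} (hε1 : ε ≤ 1) (htε : ‖t' - t‖ = ε) (hsε : ‖s' - s‖ = ε) :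
    ‖area H g₁ g₂ t' s' - area H g₁ g₂ t s‖ ≤ (2 / β + 1) ^ 2 * (4 + 6 * r) * N ^ 2 * ε ^ β := by
  have hε0 : 0 ≤ ε := htε ▸ norm_nonneg _
  have hr0 : 0 ≤ r := by linarith
  have hG₁ : GrowthBound β (5 * (r + 1)) N F₁ := hF₁.mono (by linarith)
  have hG₂ : GrowthBound β (5 * (r + 1)) N F₂ := hF₂.mono (by linarith)
  set c := 2 / β + 1 with hc
  have hc0 : 0 ≤ c := by positivity
  have hεβ : ε ^ β ≤ 1 := Real.rpow_le_one hε0 hε1 hβ.le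
  have hrβ : r ^ β ≤ r := by
    simpa using Real.rpow_le_rpow_of_exponent_le hr hβ1
  have hHd : ∀ {x x' : ℂ}, x ∈ closedUHP → x' ∈ closedUHP → ‖x‖ ≤ r → ‖x'‖ ≤ r → ‖x' - x‖ = ε →
      ‖H x' - H x‖ ≤ c ^ 2 * N ^ 2 * (2 + r) * ε ^ β := by
    intro x x' hx hx' hxr hxr' he
    have hA := norm_area_le hβ hβ1 h₁ h₂ hH hHc hN hr0 hF₁ hF₂ hx' hx hxr' hxr
    have := norm_le_of_area hβ hβ1 h₁ h₂ hN hr0 hG₁ hG₂ hx' hx hxr' hxr hA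
    rw [he] at this
    refine this.trans ?_
    gcongr
    linarith
  have d1t := h₁.norm_sub_le hβ hβ1 hN hG₁ ht' ht htr' htr
  have d1s := h₁.norm_sub_le hβ hβ1 hN hG₁ hs' hs hsr' hsr
  have d2s := h₂.norm_sub_le hβ hβ1 hN hG₂ hs' hs hsr' hsr
  rw [htε] at d1t
  rw [hsε] at d1s d2s
  have b1t := h₁.norm_le hβ hβ1 hr0 hN hG₁ ht htr
  have b1s := h₁.norm_le hβ hβ1 hr0 hN hG₁ hs hsr
  have b2s := h₂.norm_le hβ hβ1 hr0 hN hG₂ hs' hsr'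
  have hHt := hHd ht ht' htr htr' htε
  have hHs := hHd hs hs' hsr hsr' hsε
  have : area H g₁ g₂ t' s' - area H g₁ g₂ t s = (H t' - H t) - (H s' - H s)
      - ((g₁ t' - g₁ t) - (g₁ s' - g₁ s)) * g₂ s' - (g₁ t - g₁ s) * (g₂ s' - g₂ s) := by
    simp only [area]; ring
  rw [this]
  have n1 : ‖(g₁ t' - g₁ t) - (g₁ s' - g₁ s)‖ ≤ c * N * ε ^ β + c * N * ε ^ β :=
    (norm_sub_le _ _).trans (by gcongr)
  have n2 : ‖g₁ t - g₁ s‖ ≤ c * N * r + c * N * r :=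
    (norm_sub_le _ _).trans (add_le_add (b1t.trans (by gcongr)) (b1s.trans (by gcongr)))
  have n3 : ‖g₂ s'‖ ≤ c * N * r := b2s.trans (by gcongr)
  calc _ ≤ ‖H t' - H t‖ + ‖H s' - H s‖ + ‖(g₁ t' - g₁ t) - (g₁ s' - g₁ s)‖ * ‖g₂ s'‖ +
        ‖g₁ t - g₁ s‖ * ‖g₂ s' - g₂ s‖ := by
        rw [← norm_mul, ← norm_mul]
        refine (norm_sub_le _ _).trans ?_
        gcongr
        refine (norm_sub_le _ _).trans ?_
        gcongr
        exact norm_sub_le _ _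
    _ ≤ c ^ 2 * N ^ 2 * (2 + r) * ε ^ β + c ^ 2 * N ^ 2 * (2 + r) * ε ^ β +
        (c * N * ε ^ β + c * N * ε ^ β) * (c * N * r) +
        (c * N * r + c * N * r) * (c * N * ε ^ β) := by
        gcongr
    _ = _ := by ring

end

/-- Symmetrized area: `F₁ g₂ + F₂ g₁` is the derivative of `g₁ g₂`. -/
theorem area_add_area_swap {F₁ F₂ g₁ g₂ H K : ℂ → ℂ} (h₁ : IsPrimitive F₁ g₁)
    (h₂ : IsPrimitive F₂ g₂) (hH : ∀ z ∈ openUHP, HasDerivAt H (F₁ z * g₂ z) z)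
    (hHc : ContinuousOn H closedUHP) (hK : ∀ z ∈ openUHP, HasDerivAt K (F₂ z * g₁ z) z)
    (hKc : ContinuousOn K closedUHP) {t s : ℂ} (ht : t ∈ closedUHP) (hs : s ∈ closedUHP) :
    area H g₁ g₂ t s + area K g₂ g₁ t s = (g₁ t - g₁ s) * (g₂ t - g₂ s) := by
  have hopen : ∀ t ∈ openUHP, ∀ s ∈ openUHP,
      area H g₁ g₂ t s + area K g₂ g₁ t s = (g₁ t - g₁ s) * (g₂ t - g₂ s) := by
    intro t ht s hs
    have hd : ∀ z ∈ openUHP, HasDerivAt (fun z => H z + K z - g₁ z * g₂ z) 0 z := fun z hz =>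
      (((hH z hz).add (hK z hz)).sub ((h₁.hasDerivAt z hz).mul (h₂.hasDerivAt z hz))).congr_deriv
        (by ring)
    have := convex_openUHP.norm_image_sub_le_of_norm_hasDerivWithin_le (C := 0)
      (fun z hz => (hd z hz).hasDerivWithinAt) (fun z _ => by simp) hs ht
    rw [zero_mul, norm_le_zero_iff] at this
    simp only [area]
    linear_combination this
  have l1 := (tendsto_area hHc h₁.continuousOn h₂.continuousOn ht hs).add
    (tendsto_area hKc h₂.continuousOn h₁.continuousOn ht hs)
  have l2 := ((tendsto_comp_vertical h₁.continuousOn ht).sub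
    (tendsto_comp_vertical h₁.continuousOn hs)).mul ((tendsto_comp_vertical h₂.continuousOn ht).sub
    (tendsto_comp_vertical h₂.continuousOn hs))
  refine tendsto_nhds_unique (l1.congr' ?_) l2
  filter_upwards [self_mem_nhdsWithin] with ε hε using
    hopen _ (add_mem_openUHP ht hε) _ (add_mem_openUHP hs hε)

/-- The iterated integral over a segment in the open half-plane. -/
theorem segIntegral_segIntegral {F₁ F₂ g₁ g₂ H : ℂ → ℂ} (hF₁ : DifferentiableOn ℂ F₁ openUHP)
    (hF₂ : DifferentiableOn ℂ F₂ openUHP) (h₁ : IsPrimitive F₁ g₁)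
    (h₂ : IsPrimitive F₂ g₂) (hH : ∀ z ∈ openUHP, HasDerivAt H (F₁ z * g₂ z) z) {ε : ℝ}
    (hε : 0 < ε) {t s : ℂ} (ht : t ∈ closedUHP) (hs : s ∈ closedUHP) :
    segIntegral (fun u₁ => F₁ (u₁ + Complex.I * ε) *
      segIntegral (fun u₂ => F₂ (u₂ + Complex.I * ε)) s u₁) s t =
      area H g₁ g₂ (t + Complex.I * ε) (s + Complex.I * ε) := by
  have hshift : ∀ (f : ℂ → ℂ) (a b : ℂ), segIntegral (fun u => f (u + Complex.I * ε)) a b =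
      segIntegral f (a + Complex.I * ε) (b + Complex.I * ε) := by
    intro f a b
    simp only [segIntegral, add_sub_add_right_eq_sub]
    congr 2; ext r; congr 1; ring
  have ht' := add_mem_openUHP ht hε
  have hs' := add_mem_openUHP hs hε
  simp_rw [hshift F₂]
  rw [hshift (fun u => F₁ u * segIntegral F₂ (s + Complex.I * ε) u)]
  set s' := s + Complex.I * ε
  set t' := t + Complex.I * ε
  have hcong : segIntegral (fun u => F₁ u * segIntegral F₂ s' u) s' t' =
      segIntegral (fun u => F₁ u * (g₂ u - g₂ s')) s' t' := by
    rw [segIntegral, segIntegral]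
    congr 1
    refine intervalIntegral.integral_congr fun r hr => ?_
    rw [Set.uIcc_of_le zero_le_one] at hr
    rw [segIntegral_eq_sub_of_mem hs' (segment_mem_openUHP hs' ht' hr) h₂.hasDerivAt
      hF₂.continuousOn]
  rw [hcong, segIntegral_eq_sub_of_mem (G := fun u => area H g₁ g₂ u s') hs' ht']
  · simp [area]
  · intro z hz
    refine (((hH z hz).sub_const (H s')).sub
      (((h₁.hasDerivAt z hz).sub_const (g₁ s')).mul_const (g₂ s'))).congr_deriv ?_
    ring
  · exact hF₁.continuousOn.mul fun z hz =>
      ((h₂.hasDerivAt z hz).continuousAt.sub continuousAt_const).continuousWithinAt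

theorem area_chen (H g₁ g₂ : ℂ → ℂ) (t u s : ℂ) :
    area H g₁ g₂ t s - area H g₁ g₂ t u - area H g₁ g₂ u s = (g₁ t - g₁ u) * (g₂ u - g₂ s) := by
  simp only [area]; ring

/-- Interpolation between a bound in `h` and a bound in `ε`, for paths (`κ = 1`) and for areas
(`κ = 2`). -/
theorem le_of_interpolation {x a h ε κ β γ : ℝ} (hx : 0 ≤ x) (ha : 0 ≤ a) (hh : 0 ≤ h)
    (hε : 0 ≤ ε) (hγ : 0 < γ) (hγβ : γ < β) (h1 : x ≤ a * h ^ (κ * β)) (h2 : x ≤ a * ε ^ β) :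
    x ≤ a * h ^ (κ * γ) * ε ^ (β - γ) := by
  have hβ : 0 < β := hγ.trans hγβ
  have hθ : 0 ≤ γ / β := by positivity
  have hθ' : 0 ≤ 1 - γ / β := by rw [sub_nonneg, div_le_one hβ]; exact hγβ.le
  have hadd : γ / β + (1 - γ / β) = 1 := by ring
  calc x = x ^ (γ / β) * x ^ (1 - γ / β) := by
        rw [← Real.rpow_add_of_nonneg hx hθ hθ', hadd, Real.rpow_one]
    _ ≤ (a * h ^ (κ * β)) ^ (γ / β) * (a * ε ^ β) ^ (1 - γ / β) := by gcongr
    _ = (a ^ (γ / β) * a ^ (1 - γ / β)) * h ^ (κ * γ) * ε ^ (β - γ) := by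
        rw [Real.mul_rpow ha (by positivity), Real.mul_rpow ha (by positivity),
          ← Real.rpow_mul hh, ← Real.rpow_mul hε]
        have e1 : κ * β * (γ / β) = κ * γ := by field_simp
        have e2 : β * (1 - γ / β) = β - γ := by field_simp
        rw [e1, e2]; ring
    _ = _ := by rw [← Real.rpow_add_of_nonneg ha hθ hθ', hadd, Real.rpow_one]

/-! ### Hölder norms of the path and of the matrix of areas -/

section

section Norms

variable {V : Type*} [NormedAddCommGroup V]

theorem holderNorm₂_le {μ C : ℝ} (hμ : 0 ≤ μ) (hC : 0 ≤ C) {Ω : Set ℂ} {h : ℂ → ℂ → V}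
    (hh : ∀ t ∈ Ω, ∀ s ∈ Ω, ‖h t s‖ ≤ C * ‖t - s‖ ^ μ) :
    holderNorm₂ μ Ω h ≤ ENNReal.ofReal C := by
  refine iSup₂_le fun t ht => iSup₂_le fun s hs => ENNReal.div_le_of_le_mul ?_
  rw [← ofReal_norm, ← ofReal_norm, ENNReal.ofReal_rpow_of_nonneg (norm_nonneg _) hμ,
    ← ENNReal.ofReal_mul hC]
  exact ENNReal.ofReal_le_ofReal (hh t ht s hs)

theorem multiNorm₂_le {β C : ℝ} (hβ : 0 ≤ β) (hC : 0 ≤ C) {Ω : Set ℂ} {h : ℂ → ℂ → V}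
    (hh : ∀ ε ∈ Set.Icc (0 : ℝ) 1, ∀ t ∈ Ω, ∀ s ∈ Ω,
      ‖h (t + Complex.I * (ε : ℂ)) (s + Complex.I * (ε : ℂ)) - h t s‖ ≤ C * ε ^ β) :
    multiNorm₂ β Ω h ≤ ENNReal.ofReal C := by
  refine iSup₂_le fun ε hε => iSup₂_le fun t ht => iSup₂_le fun s hs =>
    ENNReal.div_le_of_le_mul ?_
  rw [← ofReal_norm, ENNReal.ofReal_rpow_of_nonneg hε.1 hβ, ← ENNReal.ofReal_mul hC]
  exact ENNReal.ofReal_le_ofReal (hh ε hε t ht s hs)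

theorem holderNorm₁_le {μ C C' : ℝ} (hμ : 0 ≤ μ) (hC : 0 ≤ C) (hC' : 0 ≤ C') {Ω : Set ℂ}
    {g : ℂ → V} (hg : ∀ t ∈ Ω, ‖g t‖ ≤ C')
    (hh : ∀ t ∈ Ω, ∀ s ∈ Ω, ‖g t - g s‖ ≤ C * ‖t - s‖ ^ μ) :
    holderNorm₁ μ Ω g ≤ ENNReal.ofReal (C' + C) := by
  rw [ENNReal.ofReal_add hC' hC]
  refine add_le_add (iSup₂_le fun t ht => ?_) (holderNorm₂_le hμ hC hh)
  rw [← ofReal_norm]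
  exact ENNReal.ofReal_le_ofReal (hg t ht)

theorem holderNorm₂_sub_le (μ : ℝ) (Ω : Set ℂ) (h k : ℂ → ℂ → V) :
    holderNorm₂ μ Ω (h - k) ≤ holderNorm₂ μ Ω h + holderNorm₂ μ Ω k := by
  refine iSup₂_le fun t ht => iSup₂_le fun s hs => ?_
  have h1 : ‖h t s‖ₑ / ‖t - s‖ₑ ^ μ ≤ holderNorm₂ μ Ω h :=
    le_iSup₂_of_le t ht (le_iSup₂_of_le s hs le_rfl)
  have h2 : ‖k t s‖ₑ / ‖t - s‖ₑ ^ μ ≤ holderNorm₂ μ Ω k :=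
    le_iSup₂_of_le t ht (le_iSup₂_of_le s hs le_rfl)
  refine le_trans ?_ (add_le_add h1 h2)
  rw [← ENNReal.add_div]
  gcongr
  exact enorm_sub_le

theorem holderNorm₁_sub_le (μ : ℝ) (Ω : Set ℂ) (g k : ℂ → V) :
    holderNorm₁ μ Ω (g - k) ≤ holderNorm₁ μ Ω g + holderNorm₁ μ Ω k := by
  have hd : delta₁ (g - k) = delta₁ g - delta₁ k := by
    ext t s; simp only [delta₁, Pi.sub_apply]; abel
  rw [holderNorm₁, hd, holderNorm₁, holderNorm₁]
  calc _ ≤ ((⨆ t ∈ Ω, ‖g t‖ₑ) + (⨆ t ∈ Ω, ‖k t‖ₑ)) +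
        (holderNorm₂ μ Ω (delta₁ g) + holderNorm₂ μ Ω (delta₁ k)) := by
        refine add_le_add (iSup₂_le fun t ht => ?_) (holderNorm₂_sub_le _ _ _ _)
        refine enorm_sub_le.trans (add_le_add ?_ ?_)
        · exact le_iSup₂_of_le t ht le_rfl
        · exact le_iSup₂_of_le t ht le_rfl
    _ = _ := by ring

theorem pairNorm_sub_le {d : ℕ} (γ : ℝ) (Ω : Set ℂ) (g k : ℂ → Fin d → ℂ)
    (h l : ℂ → ℂ → Fin d → Fin d → ℂ) :
    pairNorm γ Ω (g - k) (h - l) ≤ pairNorm γ Ω g h + pairNorm γ Ω k l := by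
  refine (add_le_add (holderNorm₁_sub_le _ _ _ _) (holderNorm₂_sub_le _ _ _ _)).trans ?_
  simp only [pairNorm]
  apply le_of_eq; ring

end Norms

variable {d : ℕ}

/-- The matrix of areas of a path `g` in `ℂ^d`, where `H i j` is a primitive of `gᵢ' gⱼ`. -/
def areaMatrix (H : Fin d → Fin d → ℂ → ℂ) (g : ℂ → Fin d → ℂ) (t s : ℂ) : Fin d → Fin d → ℂ :=
  fun i j => area (H i j) (fun z => g z i) (fun z => g z j) t s

/-- `g` is a primitive of `F` on the half-plane, and the `H i j` are primitives of the products
`Fᵢ gⱼ`, all continuous up to the boundary. -/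
structure IsLift (F : Fin d → ℂ → ℂ) (g : ℂ → Fin d → ℂ) (H : Fin d → Fin d → ℂ → ℂ) : Prop where
  isPrimitive : ∀ i, IsPrimitive (F i) fun z => g z i
  hasDerivAt : ∀ i j, ∀ z ∈ openUHP, HasDerivAt (H i j) (F i z * g z j) z
  continuousOn : ∀ i j, ContinuousOn (H i j) closedUHP

theorem norm_I_mul {ε : ℝ} (hε : 0 ≤ ε) : ‖Complex.I * (ε : ℂ)‖ = ε := by
  simp [abs_of_nonneg hε]

theorem norm_add_vertical_le {z : ℂ} {r ε : ℝ} (hz : ‖z‖ ≤ r) (hε : 0 ≤ ε) :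
    ‖z + Complex.I * (ε : ℂ)‖ ≤ r + ε :=
  (norm_add_le _ _).trans (by rw [norm_I_mul hε]; gcongr)

/-- Lowering the Hölder exponent on a bounded set. -/
theorem rpow_le_mul_rpow {h M a b : ℝ} (hh : 0 ≤ h) (hM : 1 ≤ M) (hhM : h ≤ M) (ha : 0 ≤ a)
    (hab : a ≤ b) (hab1 : b - a ≤ 1) : h ^ b ≤ M * h ^ a := by
  have e : h ^ b = h ^ (b - a) * h ^ a := by
    rw [← Real.rpow_add_of_nonneg hh (by linarith) ha]; congr 1; ring
  rw [e]
  gcongr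
  calc h ^ (b - a) ≤ M ^ (b - a) := Real.rpow_le_rpow hh hhM (by linarith)
    _ ≤ M ^ (1 : ℝ) := Real.rpow_le_rpow_of_exponent_le hM hab1
    _ = M := Real.rpow_one M

section

variable {F : Fin d → ℂ → ℂ} {g : ℂ → Fin d → ℂ} {H : Fin d → Fin d → ℂ → ℂ} (hL : IsLift F g H)
  {β γ r N : ℝ} (hγ : 0 < γ) (hγβ : γ < β) (hβ : β ≤ 1 / 2) (hr : 1 ≤ r) (hN : 1 ≤ N)
  (hF : ∀ i, GrowthBound β (25 * (r + 1)) N (F i)) {Ω : Set ℂ} (hΩ : Ω ⊆ closedUHP)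

include hL hγ hγβ hβ hr hN hF

theorem IsLift.norm_sub_le {z w : ℂ} (hz : z ∈ closedUHP) (hw : w ∈ closedUHP)
    (hzr : ‖z‖ ≤ r) (hwr : ‖w‖ ≤ r) : ‖g z - g w‖ ≤ (2 / β + 1) * N * ‖z - w‖ ^ β := by
  have hβ0 : 0 < β := hγ.trans hγβ
  refine (pi_norm_le_iff_of_nonneg (by positivity)).2 fun i => ?_
  exact (hL.isPrimitive i).norm_sub_le hβ0 (by linarith) (by linarith)
    ((hF i).mono (by linarith)) hz hw hzr hwr

theorem IsLift.norm_le {z : ℂ} (hz : z ∈ closedUHP)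
    (hzr : ‖z‖ ≤ r) : ‖g z‖ ≤ (2 / β + 1) * N * r := by
  have hβ0 : 0 < β := hγ.trans hγβ
  refine (pi_norm_le_iff_of_nonneg (by positivity)).2 fun i => ?_
  refine ((hL.isPrimitive i).norm_le hβ0 (by linarith) (by linarith) (by linarith)
    ((hF i).mono (by linarith)) hz hzr).trans ?_
  have : r ^ β ≤ r := by simpa using Real.rpow_le_rpow_of_exponent_le hr (show β ≤ 1 by linarith)
  gcongr

theorem IsLift.norm_area_le {z w : ℂ} (hz : z ∈ closedUHP) (hw : w ∈ closedUHP)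
    (hzr : ‖z‖ ≤ r) (hwr : ‖w‖ ≤ r) :
    ‖areaMatrix H g z w‖ ≤ 2 * (2 / β + 1) ^ 2 * N ^ 2 * ‖z - w‖ ^ (2 * β) := by
  have hβ0 : 0 < β := hγ.trans hγβ
  refine (pi_norm_le_iff_of_nonneg (by positivity)).2 fun i =>
    (pi_norm_le_iff_of_nonneg (by positivity)).2 fun j => ?_
  exact AnalyticFBM.norm_area_le hβ0 (by linarith) (hL.isPrimitive i) (hL.isPrimitive j)
    (hL.hasDerivAt i j) (hL.continuousOn i j) (by linarith) (by linarith) (hF i) (hF j)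
    hz hw hzr hwr

theorem IsLift.norm_area_shift_sub_le {t s : ℂ} (ht : t ∈ closedUHP) (hs : s ∈ closedUHP)
    (htr : ‖t‖ ≤ r - 1) (hsr : ‖s‖ ≤ r - 1) {ε : ℝ} (hε : ε ∈ Set.Icc (0 : ℝ) 1) :
    ‖areaMatrix H g (t + Complex.I * ε) (s + Complex.I * ε) - areaMatrix H g t s‖ ≤
      (2 / β + 1) ^ 2 * (4 + 6 * r) * N ^ 2 * ε ^ β := by
  have hβ0 : 0 < β := hγ.trans hγβ
  have hε0 := hε.1
  refine (pi_norm_le_iff_of_nonneg (by positivity)).2 fun i =>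
    (pi_norm_le_iff_of_nonneg (by positivity)).2 fun j => ?_
  exact AnalyticFBM.norm_area_shift_sub_le hβ0 (by linarith) (hL.isPrimitive i) (hL.isPrimitive j)
    (hL.hasDerivAt i j) (hL.continuousOn i j) (by linarith) hr (hF i) (hF j) ht hs (by linarith)
    (by linarith) (add_mem_closedUHP ht hε0) (add_mem_closedUHP hs hε0)
    ((norm_add_vertical_le htr hε0).trans (by linarith [hε.2]))
    ((norm_add_vertical_le hsr hε0).trans (by linarith [hε.2])) hε.2
    (by rw [add_sub_cancel_left, norm_I_mul hε0]) (by rw [add_sub_cancel_left, norm_I_mul hε0])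

include hΩ

theorem IsLift.pairNorm_le {ε : ℝ} (hε : 0 ≤ ε) (hΩr : ∀ z ∈ Ω, ‖z‖ ≤ r - ε) :
    pairNorm γ Ω (fun t => g (t + Complex.I * ε))
      (fun t s => areaMatrix H g (t + Complex.I * ε) (s + Complex.I * ε)) ≤
      ENNReal.ofReal (7 * (2 / β + 1) ^ 2 * r * N ^ 2) := by
  have hβ0 : 0 < β := hγ.trans hγβ
  set c := 2 / β + 1 with hc
  have hc1 : 1 ≤ c := by
    have : 0 ≤ 2 / β := by positivity
    linarith
  have hcN : c * N ≤ c ^ 2 * N ^ 2 := by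
    have : 1 ≤ c * N := one_le_mul_of_one_le_of_one_le hc1 hN
    nlinarith
  have hn : ∀ z ∈ Ω, ‖z + Complex.I * (ε : ℂ)‖ ≤ r := fun z hz =>
    (norm_add_vertical_le (hΩr z hz) hε).trans (by linarith)
  have hm : ∀ z ∈ Ω, z + Complex.I * (ε : ℂ) ∈ closedUHP := fun z hz =>
    add_mem_closedUHP (hΩ hz) hε
  have hd : ∀ t s : ℂ, (t + Complex.I * ε) - (s + Complex.I * ε) = t - s := fun t s => by ring
  have hts : ∀ t ∈ Ω, ∀ s ∈ Ω, ‖t - s‖ ≤ 2 * r := fun t ht s hs => by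
    have := _root_.norm_sub_le t s
    linarith [hΩr t ht, hΩr s hs]
  have b1 := holderNorm₁_le (μ := γ) (C' := c ^ 2 * N ^ 2 * r) (C := c ^ 2 * N ^ 2 * (2 * r)) hγ.le
    (by positivity) (by positivity) (Ω := Ω) (g := fun t => g (t + Complex.I * ε))
    (fun t ht => (hL.norm_le hγ hγβ hβ hr hN hF (hm t ht) (hn t ht)).trans (by gcongr))
    (fun t ht s hs => by
      refine (hL.norm_sub_le hγ hγβ hβ hr hN hF (hm t ht) (hm s hs) (hn t ht) (hn s hs)).trans ?_
      rw [hd, mul_assoc (c ^ 2 * N ^ 2)]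
      gcongr
      exact rpow_le_mul_rpow (norm_nonneg _) (by linarith) (hts t ht s hs) hγ.le hγβ.le
        (by linarith))
  have b2 := holderNorm₂_le (μ := 2 * γ) (C := 2 * c ^ 2 * N ^ 2 * (2 * r)) (by linarith)
    (by positivity) (Ω := Ω)
    (h := fun t s => areaMatrix H g (t + Complex.I * ε) (s + Complex.I * ε))
    (fun t ht s hs => by
      refine (hL.norm_area_le hγ hγβ hβ hr hN hF (hm t ht) (hm s hs) (hn t ht) (hn s hs)).trans ?_
      rw [hd, mul_assoc (2 * c ^ 2 * N ^ 2)]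
      gcongr
      exact rpow_le_mul_rpow (norm_nonneg _) (by linarith) (hts t ht s hs) (by linarith)
        (by linarith) (by linarith))
  refine (add_le_add b1 b2).trans ?_
  rw [← ENNReal.ofReal_add (by positivity) (by positivity)]
  apply le_of_eq; congr 1; ring

/-- The rate of convergence: both increments of the difference are bounded by a power of `|t - s|`
and by `ε^β`, and interpolation leaves `ε^{β-γ}`. -/
theorem IsLift.pairNorm_sub_le {ε : ℝ} (hε : ε ∈ Set.Icc (0 : ℝ) 1)
    (hΩr : ∀ z ∈ Ω, ‖z‖ ≤ r - 1) :
    pairNorm γ Ω (fun t => g (t + Complex.I * ε) - g t)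
      (fun t s => areaMatrix H g (t + Complex.I * ε) (s + Complex.I * ε) - areaMatrix H g t s) ≤
      ENNReal.ofReal (13 * (2 / β + 1) ^ 2 * r * N ^ 2 * ε ^ (β - γ)) := by
  have hβ0 : 0 < β := hγ.trans hγβ
  obtain ⟨hε0, hε1⟩ := hε
  set c := 2 / β + 1 with hc
  have hc1 : 1 ≤ c := by
    have : 0 ≤ 2 / β := by positivity
    linarith
  have hcN : c * N ≤ c ^ 2 * N ^ 2 := by
    have : 1 ≤ c * N := one_le_mul_of_one_le_of_one_le hc1 hN
    nlinarith
  have hn' : ∀ z ∈ Ω, ‖z‖ ≤ r := fun z hz => (hΩr z hz).trans (by linarith)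
  have hn : ∀ z ∈ Ω, ‖z + Complex.I * (ε : ℂ)‖ ≤ r := fun z hz =>
    (norm_add_vertical_le (hΩr z hz) hε0).trans (by linarith)
  have hm : ∀ z ∈ Ω, z + Complex.I * (ε : ℂ) ∈ closedUHP := fun z hz =>
    add_mem_closedUHP (hΩ hz) hε0
  have hd : ∀ t s : ℂ, (t + Complex.I * ε) - (s + Complex.I * ε) = t - s := fun t s => by ring
  have hgε : ∀ t ∈ Ω, ‖g (t + Complex.I * ε) - g t‖ ≤ c * N * ε ^ β := fun t ht => by
    have := hL.norm_sub_le hγ hγβ hβ hr hN hF (hm t ht) (hΩ ht) (hn t ht) (hn' t ht)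
    rwa [add_sub_cancel_left, norm_I_mul hε0] at this
  have hεe : ε ^ β ≤ ε ^ (β - γ) := by
    rcases hε0.eq_or_lt with h | h
    · rw [← h, Real.zero_rpow hβ0.ne', Real.zero_rpow (by linarith)]
    · exact Real.rpow_le_rpow_of_exponent_ge h hε1 (by linarith)
  have b1 := holderNorm₁_le (μ := γ) (C' := c ^ 2 * N ^ 2 * ε ^ (β - γ))
    (C := 2 * (c ^ 2 * N ^ 2) * ε ^ (β - γ)) hγ.le
    (by positivity) (by positivity) (Ω := Ω) (g := fun t => g (t + Complex.I * ε) - g t)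
    (fun t ht => (hgε t ht).trans (by gcongr))
    (fun t ht s hs => by
      have e1 : ‖(g (t + Complex.I * ε) - g t) - (g (s + Complex.I * ε) - g s)‖ ≤
          2 * (c * N) * ε ^ β :=
        (_root_.norm_sub_le _ _).trans (by linarith [hgε t ht, hgε s hs])
      have e2 : ‖(g (t + Complex.I * ε) - g t) - (g (s + Complex.I * ε) - g s)‖ ≤
          2 * (c * N) * ‖t - s‖ ^ (1 * β) := by
        have h1 := hL.norm_sub_le hγ hγβ hβ hr hN hF (hm t ht) (hm s hs) (hn t ht) (hn s hs)
        have h2 := hL.norm_sub_le hγ hγβ hβ hr hN hF (hΩ ht) (hΩ hs) (hn' t ht) (hn' s hs)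
        rw [hd] at h1
        rw [sub_sub_sub_comm, one_mul]
        exact (_root_.norm_sub_le _ _).trans (by linarith)
      have := le_of_interpolation (norm_nonneg _) (by positivity) (norm_nonneg _) hε0 hγ hγβ e2 e1
      rw [one_mul] at this
      refine this.trans ?_
      calc 2 * (c * N) * ‖t - s‖ ^ γ * ε ^ (β - γ)
          ≤ 2 * (c ^ 2 * N ^ 2) * ‖t - s‖ ^ γ * ε ^ (β - γ) := by gcongr
        _ = _ := by ring)
  have b2 := holderNorm₂_le (μ := 2 * γ) (C := c ^ 2 * (4 + 6 * r) * N ^ 2 * ε ^ (β - γ))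
    (by linarith) (by positivity) (Ω := Ω)
    (h := fun t s => areaMatrix H g (t + Complex.I * ε) (s + Complex.I * ε) - areaMatrix H g t s)
    (fun t ht s hs => by
      have e1 := hL.norm_area_shift_sub_le hγ hγβ hβ hr hN hF (hΩ ht) (hΩ hs) (hΩr t ht) (hΩr s hs)
        ⟨hε0, hε1⟩
      have h1 := hL.norm_area_le hγ hγβ hβ hr hN hF (hm t ht) (hm s hs) (hn t ht) (hn s hs)
      have h2 := hL.norm_area_le hγ hγβ hβ hr hN hF (hΩ ht) (hΩ hs) (hn' t ht) (hn' s hs)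
      rw [hd] at h1
      have e2 : ‖areaMatrix H g (t + Complex.I * ε) (s + Complex.I * ε) - areaMatrix H g t s‖ ≤
          c ^ 2 * (4 + 6 * r) * N ^ 2 * ‖t - s‖ ^ (2 * β) := by
        refine (_root_.norm_sub_le _ _).trans ((add_le_add h1 h2).trans ?_)
        have : 0 ≤ c ^ 2 * r * N ^ 2 * ‖t - s‖ ^ (2 * β) := by positivity
        rw [← hc]
        linarith
      have := le_of_interpolation (norm_nonneg _) (by positivity) (norm_nonneg _) hε0 hγ hγβ e2 e1
      refine this.trans (le_of_eq ?_)
      ring)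
  refine (add_le_add b1 b2).trans ?_
  rw [← ENNReal.ofReal_add (by positivity) (by positivity)]
  apply ENNReal.ofReal_le_ofReal
  have : 0 ≤ c ^ 2 * (r - 1) * N ^ 2 * ε ^ (β - γ) :=
    mul_nonneg (mul_nonneg (mul_nonneg (by positivity) (by linarith)) (by positivity))
      (by positivity)
  linarith

theorem IsLift.multiNorm_le (hΩr : ∀ z ∈ Ω, ‖z‖ ≤ r - 1) :
    multiNorm₂ γ Ω (areaMatrix H g) ≤
      ENNReal.ofReal ((2 / β + 1) ^ 2 * (4 + 6 * r) * N ^ 2) := by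
  have hβ0 : 0 < β := hγ.trans hγβ
  refine multiNorm₂_le hγ.le (by positivity) fun ε hε t ht s hs => ?_
  refine (hL.norm_area_shift_sub_le hγ hγβ hβ hr hN hF (hΩ ht) (hΩ hs) (hΩr t ht) (hΩr s hs)
    hε).trans ?_
  gcongr ?_ * ?_
  rcases hε.1.eq_or_lt with h | h
  · rw [← h, Real.zero_rpow hβ0.ne', Real.zero_rpow hγ.ne']
  · exact Real.rpow_le_rpow_of_exponent_ge h hε.2 hγβ.le

end

end

/-! ### Gaussian moments, the binomial series and the mean value inequality -/

/-- A linear combination `X` of independent standard Gaussians with variance at most `V` has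
`E X^{2m} ≤ C_m V^m`, because `(tX)^{2m} / (2m)! ≤ exp(tX) + exp(-tX)` with `t = V^{-1/2}`. -/
theorem lintegral_sum_gaussian_pow_le {U ι : Type*} [MeasurableSpace U] {P : Measure U}
    [IsProbabilityMeasure P] {ξ : ι → U → ℝ} (hξ_meas : ∀ q, Measurable (ξ q))
    (hξ_law : ∀ q, P.map (ξ q) = gaussianReal 0 1) (hξ_indep : iIndepFun ξ P)
    (s : Finset ι) (b : ι → ℝ) {V : ℝ} (hV : 0 < V) (hb : ∑ q ∈ s, b q ^ 2 ≤ V) (m : ℕ) :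
    ∫⁻ ω, ENNReal.ofReal ((∑ q ∈ s, b q * ξ q ω) ^ (2 * m)) ∂P ≤
      ENNReal.ofReal ((2 * m).factorial * (2 * Real.exp (1 / 2)) * V ^ m) := by
  set X : ι → U → ℝ := fun q ω => b q * ξ q ω with hX
  have hXm : ∀ q, Measurable (X q) := fun q => (hξ_meas q).const_mul (b q)
  have hXi : iIndepFun X P := hξ_indep.comp (fun q x => b q * x) fun q => measurable_const_mul (b q)
  have hint1 : ∀ (t : ℝ) q, Integrable (fun ω => Real.exp (t * X q ω)) P := by
    intro t q
    have h : Integrable (fun x => Real.exp ((t * b q) * x)) (P.map (ξ q)) := by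
      rw [hξ_law q]; exact integrable_exp_mul_gaussianReal _
    refine (h.comp_measurable (hξ_meas q)).congr (ae_of_all _ fun ω => ?_)
    simp [hX, mul_assoc]
  have hint : ∀ t : ℝ, Integrable (fun ω => Real.exp (t * (∑ q ∈ s, X q) ω)) P := fun t =>
    hXi.integrable_exp_mul_sum hXm fun q _ => hint1 t q
  have hmgf : ∀ t : ℝ, t ^ 2 * V = 1 →
      ∫ ω, Real.exp (t * (∑ q ∈ s, X q) ω) ∂P ≤ Real.exp (1 / 2) := by
    intro t ht
    have h1 : ∀ q, mgf (X q) P t = Real.exp ((t ^ 2 / 2) * b q ^ 2) := by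
      intro q
      have : mgf (X q) P t = mgf (ξ q) P (b q * t) := by
        simp only [mgf, hX]; congr 1; ext ω; congr 1; ring
      rw [this, mgf_gaussianReal (hξ_law q)]
      congr 1; simp; ring
    change mgf (∑ q ∈ s, X q) P t ≤ _
    rw [hXi.mgf_sum hXm, Finset.prod_congr rfl fun q _ => h1 q, ← Real.exp_sum, ← Finset.mul_sum]
    apply Real.exp_le_exp.2
    calc t ^ 2 / 2 * ∑ q ∈ s, b q ^ 2 ≤ t ^ 2 / 2 * V := by gcongr
      _ = 1 / 2 := by linarith
  set t := (Real.sqrt V)⁻¹ with ht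
  have htV : t ^ 2 * V = 1 := by
    rw [ht, inv_pow, Real.sq_sqrt hV.le, inv_mul_cancel₀ hV.ne']
  have hpt : ∀ x : ℝ, x ^ (2 * m) ≤
      (2 * m).factorial * V ^ m * (Real.exp (t * x) + Real.exp (-t * x)) := by
    intro x
    have h1 := Real.pow_div_factorial_le_exp |t * x| (abs_nonneg _) (2 * m)
    rw [(even_two_mul m).pow_abs, div_le_iff₀ (by positivity)] at h1
    have h2 : Real.exp |t * x| ≤ Real.exp (t * x) + Real.exp (-t * x) := by
      rcases abs_cases (t * x) with h | h <;> rw [h.1]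
      · linarith [Real.exp_pos (-t * x)]
      · rw [← neg_mul]; linarith [Real.exp_pos (t * x)]
    have h3 : x ^ (2 * m) = V ^ m * (t * x) ^ (2 * m) := by
      rw [mul_pow, pow_mul t, ← mul_assoc, ← mul_pow, mul_comm V, htV, one_pow, one_mul]
    rw [h3]
    calc V ^ m * (t * x) ^ (2 * m) ≤ V ^ m * (Real.exp |t * x| * (2 * m).factorial) := by gcongr
      _ ≤ V ^ m * ((Real.exp (t * x) + Real.exp (-t * x)) * (2 * m).factorial) := by gcongr
      _ = _ := by ring
  have hi2 := ((hint t).add (hint (-t))).const_mul ((2 * m).factorial * V ^ m : ℝ)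
  calc ∫⁻ ω, ENNReal.ofReal ((∑ q ∈ s, b q * ξ q ω) ^ (2 * m)) ∂P
      ≤ ∫⁻ ω, ENNReal.ofReal ((2 * m).factorial * V ^ m *
          (Real.exp (t * (∑ q ∈ s, X q) ω) + Real.exp (-t * (∑ q ∈ s, X q) ω))) ∂P := by
        refine lintegral_mono fun ω => ENNReal.ofReal_le_ofReal ?_
        rw [Finset.sum_apply]
        exact hpt _
    _ = ENNReal.ofReal (∫ ω, ((2 * m).factorial * V ^ m *
          (Real.exp (t * (∑ q ∈ s, X q) ω) + Real.exp (-t * (∑ q ∈ s, X q) ω))) ∂P) :=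
        (ofReal_integral_eq_lintegral_ofReal hi2 (ae_of_all _ fun ω => by
          simp only [Pi.add_apply, Pi.zero_apply]; positivity)).symm
    _ ≤ _ := by
        apply ENNReal.ofReal_le_ofReal
        rw [integral_const_mul, integral_add (hint t) (hint (-t))]
        have e1 := hmgf t htV
        have e2 := hmgf (-t) (by rw [neg_sq, htV])
        calc _ ≤ (2 * m).factorial * V ^ m * (Real.exp (1 / 2) + Real.exp (1 / 2)) := by gcongr
          _ = _ := by ring

/-- The partial sums of the binomial series of `(1 - x)^{-a}`. -/
theorem sum_ascPochhammer_le {a x : ℝ} (ha : 0 < a) (hx : 0 ≤ x) (hx1 : x < 1) (n : ℕ) :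
    ∑ k ∈ Finset.range n, (ascPochhammer ℝ k).eval a / k.factorial * x ^ k ≤ (1 - x) ^ (-a) := by
  have h := (Real.one_div_one_sub_rpow_hasFPowerSeriesOnBall_zero a).hasSum (y := x) (by
    simp [enorm_eq_nnnorm, ← NNReal.coe_lt_coe, abs_of_nonneg hx, hx1])
  have hk : ∀ k : ℕ, Ring.choose (a + k - 1) k = (ascPochhammer ℝ k).eval a / k.factorial := by
    intro k
    have h1 := Ring.factorial_nsmul_multichoose_eq_ascPochhammer a k
    rw [Ring.choose, show a + k - 1 - k + 1 = a by ring, eq_div_iff (by positivity), mul_comm,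
      ← nsmul_eq_mul, h1, Polynomial.ascPochhammer_smeval_eq_eval]
  simp only [FormalMultilinearSeries.ofScalars_apply_eq, zero_add, smul_eq_mul, hk] at h
  rw [one_div, ← Real.rpow_neg (by linarith)] at h
  exact sum_le_hasSum _ (fun k _ => by
    have := ascPochhammer_pos k a ha
    positivity) h

/-- The mean value inequality over a disc, from the mean value property over circles. -/
theorem enorm_mul_le_lintegral_ball {f : ℂ → ℂ} {c : ℂ} {r : ℝ} (hr : 0 < r)
    (hf : DifferentiableOn ℂ f (Metric.ball c r)) :
    ‖f c‖ₑ * ENNReal.ofReal (Real.pi * r ^ 2) ≤ ∫⁻ z in Metric.ball c r, ‖f z‖ₑ := by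
  set S : Set (ℝ × ℝ) := Set.Ioo 0 r ×ˢ Set.Ioo (-Real.pi) Real.pi with hS
  have hSm : MeasurableSet S := measurableSet_Ioo.prod measurableSet_Ioo
  have hsub : S ⊆ polarCoord.target := Set.prod_mono Set.Ioo_subset_Ioi_self le_rfl
  have hmap : ∀ p : ℝ × ℝ, c + Complex.polarCoord.symm p = circleMap c p.1 p.2 := fun p => by
    simp [circleMap, Complex.exp_mul_I]
  have hmem : ∀ ρ ∈ Set.Ioo 0 r, ∀ θ, circleMap c ρ θ ∈ Metric.ball c r := fun ρ hρ θ => by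
    simp [circleMap, abs_of_pos hρ.1, hρ.2]
  have hcirc : ∀ ρ ∈ Set.Ioo 0 r, ENNReal.ofReal (2 * Real.pi) * ‖f c‖ₑ ≤
      ∫⁻ θ in Set.Ioo (-Real.pi) Real.pi, ‖f (circleMap c ρ θ)‖ₑ := by
    intro ρ hρ
    have hd : DiffContOnCl ℂ f (Metric.ball c |ρ|) := by
      refine (hf.mono ?_).diffContOnCl
      refine Metric.closure_ball_subset_closedBall.trans (Metric.closedBall_subset_ball ?_)
      rw [abs_of_pos hρ.1]; exact hρ.2
    have h1 := hd.circleAverage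
    rw [Real.circleAverage_def] at h1
    have h2 : ∫ θ in (0 : ℝ)..2 * Real.pi, f (circleMap c ρ θ) =
        ∫ θ in Set.Ioo (-Real.pi) Real.pi, f (circleMap c ρ θ) := by
      have hp : Function.Periodic (fun θ => f (circleMap c ρ θ)) (2 * Real.pi) := fun θ => by
        simp only [periodic_circleMap c ρ θ]
      have := hp.intervalIntegral_add_eq 0 (-Real.pi)
      rw [zero_add, show -Real.pi + 2 * Real.pi = Real.pi by ring] at this
      rw [this, intervalIntegral.integral_of_le (by linarith [Real.pi_pos]),
        integral_Ioc_eq_integral_Ioo]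
    rw [h2] at h1
    refine le_trans (le_of_eq ?_) (enorm_integral_le_lintegral_enorm _)
    rw [← h1, enorm_smul, ← mul_assoc, Real.enorm_of_nonneg (by positivity),
      ← ENNReal.ofReal_mul (by positivity), mul_inv_cancel₀ (by positivity)]
    simp
  have hpolar : ∫⁻ z in Metric.ball c r, ‖f z‖ₑ =
      ∫⁻ p in polarCoord.target, ENNReal.ofReal p.1 •
        (Metric.ball c r).indicator (fun z => ‖f z‖ₑ) (c + Complex.polarCoord.symm p) := by
    rw [Complex.lintegral_comp_polarCoord_symm
      (fun z => (Metric.ball c r).indicator (fun z => ‖f z‖ₑ) (c + z)),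
      lintegral_add_left_eq_self (fun z => (Metric.ball c r).indicator (fun z => ‖f z‖ₑ) z),
      lintegral_indicator Metric.isOpen_ball.measurableSet]
  rw [hpolar]
  calc ‖f c‖ₑ * ENNReal.ofReal (Real.pi * r ^ 2)
      = (∫⁻ ρ in Set.Ioo 0 r, ENNReal.ofReal ρ) * (ENNReal.ofReal (2 * Real.pi) * ‖f c‖ₑ) := by
        have : ∫⁻ ρ in Set.Ioo 0 r, ENNReal.ofReal ρ = ENNReal.ofReal (r ^ 2 / 2) := by
          rw [← ofReal_integral_eq_lintegral_ofReal]
          · rw [← integral_Ioc_eq_integral_Ioo, ← intervalIntegral.integral_of_le hr.le]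
            simp
          · exact (continuous_id.integrableOn_Icc (a := 0) (b := r)).mono_set
              Set.Ioo_subset_Icc_self
          · filter_upwards [ae_restrict_mem measurableSet_Ioo] with x hx using hx.1.le
        rw [this, ← mul_assoc, ← ENNReal.ofReal_mul (by positivity), mul_comm]
        congr 2; ring
    _ = ∫⁻ ρ in Set.Ioo 0 r, ENNReal.ofReal ρ * (ENNReal.ofReal (2 * Real.pi) * ‖f c‖ₑ) := by
        rw [lintegral_mul_const _ (by fun_prop)]
    _ ≤ ∫⁻ ρ in Set.Ioo 0 r, ENNReal.ofReal ρ *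
          ∫⁻ θ in Set.Ioo (-Real.pi) Real.pi, ‖f (circleMap c ρ θ)‖ₑ := by
        refine setLIntegral_mono' measurableSet_Ioo fun ρ hρ => ?_
        gcongr
        exact hcirc ρ hρ
    _ = ∫⁻ ρ in Set.Ioo 0 r, ∫⁻ θ in Set.Ioo (-Real.pi) Real.pi,
          ENNReal.ofReal ρ * ‖f (circleMap c ρ θ)‖ₑ := by
        congr 1; ext ρ
        rw [lintegral_const_mul' _ _ ENNReal.ofReal_ne_top]
    _ = ∫⁻ p in S, ENNReal.ofReal p.1 * ‖f (circleMap c p.1 p.2)‖ₑ := by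
        rw [hS, Measure.volume_eq_prod, ← Measure.prod_restrict, lintegral_prod]
        rw [Measure.prod_restrict]
        refine (ENNReal.measurable_ofReal.comp measurable_fst).aemeasurable.mul ?_
        have hc : ContinuousOn (fun p : ℝ × ℝ => f (circleMap c p.1 p.2))
            (Set.Ioo 0 r ×ˢ Set.Ioo (-Real.pi) Real.pi) := by
          refine hf.continuousOn.comp ?_ fun p hp => hmem p.1 hp.1 p.2
          refine Continuous.continuousOn ?_
          simp only [circleMap]
          fun_prop
        exact (hc.aemeasurable hSm).enorm
    _ = ∫⁻ p in S, ENNReal.ofReal p.1 •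
        (Metric.ball c r).indicator (fun z => ‖f z‖ₑ) (c + Complex.polarCoord.symm p) := by
        refine setLIntegral_congr_fun hSm fun p hp => ?_
        rw [hmap, Set.indicator_of_mem (hmem p.1 hp.1 p.2), smul_eq_mul]
    _ ≤ _ := lintegral_mono_set hsub

/-! ### The basis functions and the convergence of the series -/

/-- The constant in the diagonal `∑ₖ |fₖ(z)|² = C (Im z)^{2α-2}` of the covariance kernel. -/
noncomputable def kernelConst (α : ℝ) : ℝ :=
  (2 : ℝ) ^ (2 * (α - 1)) * (α * (1 - 2 * α) / (2 * Real.cos (Real.pi * α)))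

theorem kernelConst_pos {α : ℝ} (hα : α ∈ Set.Ioo (0 : ℝ) (1 / 2)) : 0 < kernelConst α := by
  have hcos : 0 < Real.cos (Real.pi * α) := Real.cos_pos_of_mem_Ioo
    ⟨by nlinarith [Real.pi_pos, hα.1], by nlinarith [Real.pi_pos, hα.2]⟩
  have h1 : 0 < 1 - 2 * α := by linarith [hα.2]
  have h0 := hα.1
  unfold kernelConst
  positivity

/-- The real coefficient in `basisFun`. -/
noncomputable def basisCoeff (α : ℝ) (k : ℕ) : ℝ :=
  (2 : ℝ) ^ (α - 1) *
      Real.sqrt (α * (1 - 2 * α) * (ascPochhammer ℝ k).eval (2 - 2 * α) /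
        (2 * Real.cos (Real.pi * α) * (k.factorial : ℝ)))

theorem basisFun_eq (α : ℝ) (k : ℕ) (z : ℂ) :
    basisFun α k z = (basisCoeff α k : ℂ) *
      ((z + Complex.I) / (2 * Complex.I)) ^ ((2 * α - 2 : ℝ) : ℂ) *
      ((z - Complex.I) / (z + Complex.I)) ^ k := rfl

theorem basisCoeff_sq {α : ℝ} (hα : α ∈ Set.Ioo (0 : ℝ) (1 / 2)) (k : ℕ) :
    basisCoeff α k ^ 2 = kernelConst α * ((ascPochhammer ℝ k).eval (2 - 2 * α) / k.factorial) := by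
  have hcos : 0 < Real.cos (Real.pi * α) := Real.cos_pos_of_mem_Ioo
    ⟨by nlinarith [Real.pi_pos, hα.1], by nlinarith [Real.pi_pos, hα.2]⟩
  have h1 : 0 < 1 - 2 * α := by linarith [hα.2]
  have h0 := hα.1
  have hp := ascPochhammer_pos k (2 - 2 * α) (by linarith)
  rw [basisCoeff, mul_pow, Real.sq_sqrt (by positivity), kernelConst, mul_comm 2 (α - 1),
    Real.rpow_mul (by norm_num)]
  simp only [Real.rpow_ofNat]
  field_simp

theorem ascPochhammer_div_factorial_le {a : ℝ} (ha : 0 < a) (ha2 : a ≤ 2) (k : ℕ) :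
    (ascPochhammer ℝ k).eval a / k.factorial ≤ k + 1 := by
  induction k with
  | zero => simp
  | succ k ih =>
    rw [ascPochhammer_succ_eval, Nat.factorial_succ]
    push_cast
    have hp := ascPochhammer_pos k a ha
    calc (ascPochhammer ℝ k).eval a * (a + k) / ((k + 1) * k.factorial)
        = (ascPochhammer ℝ k).eval a / k.factorial * ((a + k) / (k + 1)) := by field_simp
      _ ≤ (k + 1) * ((2 + k) / (k + 1)) := by gcongr
      _ = _ := by field_simp; ring

/-- The Cayley transform maps the half-plane to the disc. -/
theorem one_sub_norm_cayley_sq {z : ℂ} (hz : z ∈ openUHP) :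
    0 < ‖z + Complex.I‖ ∧
    1 - ‖(z - Complex.I) / (z + Complex.I)‖ ^ 2 = 4 * z.im / ‖z + Complex.I‖ ^ 2 := by
  have hz0 : 0 < z.im := hz
  have hne : 0 < ‖z + Complex.I‖ := norm_pos_iff.2 fun h => by
    have := congrArg Complex.im h
    simp at this
    linarith
  refine ⟨hne, ?_⟩
  rw [norm_div, div_pow, eq_div_iff (by positivity), sub_mul, one_mul,
    div_mul_cancel₀ _ (by positivity), ← Complex.normSq_eq_norm_sq, ← Complex.normSq_eq_norm_sq,
    Complex.normSq_apply, Complex.normSq_apply]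
  simp
  ring

/-- The diagonal of the covariance kernel: with `w` the Cayley transform of `z`, the binomial series
sums to `(1 - |w|²)^{2α-2}`, and `(1 - |w|²) |z + 𝐢|² / 4 = Im z`. -/
theorem sum_norm_basisFun_sq_le {α : ℝ} (hα : α ∈ Set.Ioo (0 : ℝ) (1 / 2)) {z : ℂ}
    (hz : z ∈ openUHP) (n : ℕ) :
    ∑ k ∈ Finset.range n, ‖basisFun α k z‖ ^ 2 ≤ kernelConst α * z.im ^ (2 * α - 2) := by
  have hz0 : 0 < z.im := hz
  obtain ⟨hne, hw⟩ := one_sub_norm_cayley_sq hz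
  set w := (z - Complex.I) / (z + Complex.I) with hwdef
  have hK := kernelConst_pos hα
  have hterm : ∀ k, ‖basisFun α k z‖ ^ 2 = kernelConst α * (‖z + Complex.I‖ ^ 2 / 4) ^ (2 * α - 2) *
      ((ascPochhammer ℝ k).eval (2 - 2 * α) / k.factorial * (‖w‖ ^ 2) ^ k) := by
    intro k
    rw [basisFun_eq, norm_mul, norm_mul, mul_pow, mul_pow, Complex.norm_real, Real.norm_eq_abs,
      sq_abs, basisCoeff_sq hα, Complex.norm_cpow_real, norm_pow, ← hwdef]
    have e1 : ‖(z + Complex.I) / (2 * Complex.I)‖ = ‖z + Complex.I‖ / 2 := by simp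
    have e2 : ((‖z + Complex.I‖ / 2) ^ (2 * α - 2)) ^ 2 =
        (‖z + Complex.I‖ ^ 2 / 4) ^ (2 * α - 2) := by
      rw [← Real.rpow_natCast, ← Real.rpow_mul (by positivity), mul_comm,
        Real.rpow_mul (by positivity)]
      congr 1
      simp; ring
    rw [e1, e2]; ring
  have hw1 : ‖w‖ ^ 2 < 1 := by
    have : 0 < 4 * z.im / ‖z + Complex.I‖ ^ 2 := by positivity
    linarith
  rw [Finset.sum_congr rfl fun k _ => hterm k, ← Finset.mul_sum]
  calc _ ≤ kernelConst α * (‖z + Complex.I‖ ^ 2 / 4) ^ (2 * α - 2) *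
        (1 - ‖w‖ ^ 2) ^ (-(2 - 2 * α)) := by
        gcongr
        exact sum_ascPochhammer_le (by linarith [hα.2]) (by positivity) hw1 n
    _ = _ := by
        rw [hw, neg_sub, mul_assoc, ← Real.mul_rpow (by positivity) (by positivity)]
        congr 2
        field_simp

theorem summable_cube_mul_geometric {ρ : ℝ} (hρ : 0 ≤ ρ) (hρ1 : ρ < 1) :
    Summable fun k : ℕ => ((k : ℝ) + 1) ^ 3 * ρ ^ k := by
  have h1 := summable_pow_mul_geometric_of_norm_lt_one (R := ℝ) 3
    (by rwa [Real.norm_of_nonneg hρ] : ‖ρ‖ < 1)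
  have h2 := summable_geometric_of_lt_one hρ hρ1
  refine Summable.of_nonneg_of_le (fun k => by positivity) (fun k => ?_)
    ((h1.add h2).mul_left (2 ^ (3 - 1)))
  have := add_pow_le (Nat.cast_nonneg (α := ℝ) k) zero_le_one 3
  calc ((k : ℝ) + 1) ^ 3 * ρ ^ k ≤ (2 ^ (3 - 1) * ((k : ℝ) ^ 3 + 1 ^ 3)) * ρ ^ k := by gcongr
    _ = _ := by ring

theorem basisCoeff_le {α : ℝ} (hα : α ∈ Set.Ioo (0 : ℝ) (1 / 2)) (k : ℕ) :
    |basisCoeff α k| ≤ (kernelConst α + 1) * (k + 1) := by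
  have hK := kernelConst_pos hα
  refine abs_le_of_sq_le_sq ?_ (by positivity)
  rw [basisCoeff_sq hα]
  have h1 := ascPochhammer_div_factorial_le (a := 2 - 2 * α) (by linarith [hα.2])
    (by linarith [hα.1]) k
  have hk : (0 : ℝ) ≤ k := Nat.cast_nonneg k
  calc _ ≤ kernelConst α * (k + 1) := by gcongr
    _ ≤ (kernelConst α + 1) ^ 2 * (k + 1) ^ 2 := by
        gcongr
        · nlinarith
        · nlinarith
    _ = _ := by ring

section

variable {U : Type*} {d : ℕ}

/-- If the coefficients grow polynomially, the series `Γ'` converges to a holomorphic function. -/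
theorem hasSum_gammaDeriv {α : ℝ} (hα : α ∈ Set.Ioo (0 : ℝ) (1 / 2))
    {ξ : Fin d × ℕ × Fin 2 → U → ℝ} {ω : U} {i : Fin d} {M : ℝ}
    (hM : ∀ k, ‖complexGaussian ξ i k ω‖ ≤ M * (k + 1) ^ 2) :
    (∀ z ∈ openUHP, HasSum (fun k => basisFun α k z * complexGaussian ξ i k ω)
      (gammaDeriv α ξ ω z i)) ∧
    DifferentiableOn ℂ (fun z => gammaDeriv α ξ ω z i) openUHP := by
  have hK := kernelConst_pos hα
  have hM0 : 0 ≤ M := by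
    have := (norm_nonneg _).trans (hM 0)
    simpa using this
  set c : ℕ → ℂ := fun k => (basisCoeff α k : ℂ) * complexGaussian ξ i k ω with hc
  have hcb : ∀ k, ‖c k‖ ≤ (kernelConst α + 1) * M * (k + 1) ^ 3 := by
    intro k
    rw [hc, norm_mul, Complex.norm_real, Real.norm_eq_abs]
    calc _ ≤ ((kernelConst α + 1) * (k + 1)) * (M * (k + 1) ^ 2) := by
          gcongr
          · exact basisCoeff_le hα k
          · exact hM k
      _ = _ := by ring
  have hterm : ∀ (ρ : ℝ) k (w : ℂ), ‖w‖ ≤ ρ →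
      ‖c k * w ^ k‖ ≤ (kernelConst α + 1) * M * (((k : ℝ) + 1) ^ 3 * ρ ^ k) := by
    intro ρ k w hw
    rw [norm_mul, norm_pow, ← mul_assoc]
    have := (norm_nonneg _).trans hw
    gcongr
    exact hcb k
  have hsum : ∀ w : ℂ, ‖w‖ < 1 → Summable fun k => c k * w ^ k := fun w hw =>
    Summable.of_norm_bounded ((summable_cube_mul_geometric (norm_nonneg w) hw).mul_left _)
      fun k => hterm _ k w le_rfl
  have hdiff : DifferentiableOn ℂ (fun w => ∑' k, c k * w ^ k) (Metric.ball 0 1) := by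
    intro w hw
    obtain ⟨ρ, hρ, hρ1⟩ := exists_between (mem_ball_zero_iff.1 hw)
    have hρ0 : 0 ≤ ρ := (norm_nonneg w).trans hρ.le
    have := Complex.differentiableOn_tsum_of_summable_norm (F := fun k w => c k * w ^ k)
      (U := Metric.ball 0 ρ)
      ((summable_cube_mul_geometric hρ0 hρ1).mul_left ((kernelConst α + 1) * M))
      (fun k => by fun_prop) Metric.isOpen_ball
      (fun k w hw => hterm ρ k w (mem_ball_zero_iff.1 hw).le)
    exact (this.differentiableAt (Metric.isOpen_ball.mem_nhds
      (mem_ball_zero_iff.2 hρ))).differentiableWithinAt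
  have hball : ∀ z ∈ openUHP, ‖(z - Complex.I) / (z + Complex.I)‖ < 1 := by
    intro z hz
    have hz0 : 0 < z.im := hz
    obtain ⟨hne, hw⟩ := one_sub_norm_cayley_sq hz
    have : 0 < 4 * z.im / ‖z + Complex.I‖ ^ 2 := by positivity
    exact (sq_lt_one_iff₀ (norm_nonneg _)).1 (by linarith)
  have heq : ∀ z k, basisFun α k z * complexGaussian ξ i k ω =
      ((z + Complex.I) / (2 * Complex.I)) ^ ((2 * α - 2 : ℝ) : ℂ) *
        (c k * ((z - Complex.I) / (z + Complex.I)) ^ k) := by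
    intro z k
    rw [basisFun_eq, hc]; ring
  have hg : ∀ z ∈ openUHP, gammaDeriv α ξ ω z i =
      ((z + Complex.I) / (2 * Complex.I)) ^ ((2 * α - 2 : ℝ) : ℂ) *
        ∑' k, c k * ((z - Complex.I) / (z + Complex.I)) ^ k := by
    intro z hz
    rw [gammaDeriv, ← tsum_mul_left]
    exact tsum_congr fun k => heq z k
  constructor
  · intro z hz
    have : Summable fun k => basisFun α k z * complexGaussian ξ i k ω := by
      simp_rw [heq]
      exact (hsum _ (hball z hz)).mul_left _
    exact this.hasSum
  · refine DifferentiableOn.congr ?_ hg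
    have hne : ∀ z ∈ openUHP, z + Complex.I ≠ 0 := fun z hz =>
      norm_pos_iff.1 (one_sub_norm_cayley_sq hz).1
    refine DifferentiableOn.mul ?_ ?_
    · refine DifferentiableOn.cpow (by fun_prop) (by fun_prop) fun z hz => Or.inl ?_
      have hz0 : 0 < z.im := hz
      have : ((z + Complex.I) / (2 * Complex.I)).re = (z.im + 1) / 2 := by
        rw [show (z + Complex.I) / (2 * Complex.I) = (z + Complex.I) * (-Complex.I) / 2 by
          field_simp; ring_nf; simp]
        simp
      rw [this]; linarith
    · refine hdiff.comp ?_ fun z hz => mem_ball_zero_iff.2 (hball z hz)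
      exact DifferentiableOn.div (by fun_prop) (by fun_prop) hne

variable [MeasurableSpace U] {P : Measure U}

theorem measurable_complexGaussian {ξ : Fin d × ℕ × Fin 2 → U → ℝ}
    (hξ_meas : ∀ q, Measurable (ξ q)) (i : Fin d) (k : ℕ) :
    Measurable (complexGaussian ξ i k) := by
  have h0 := hξ_meas (i, k, 0)
  have h1 := hξ_meas (i, k, 1)
  unfold complexGaussian
  fun_prop

/-- Almost surely the Gaussian coefficients grow at most quadratically. -/
theorem ae_complexGaussian_le {ξ : Fin d × ℕ × Fin 2 → U → ℝ}
    (hξ_meas : ∀ q, Measurable (ξ q)) (hξ_law : ∀ q, P.map (ξ q) = gaussianReal 0 1) :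
    ∀ᵐ ω ∂P, ∀ i, ∃ M : ℝ, ∀ k, ‖complexGaussian ξ i k ω‖ ≤ M * (k + 1) ^ 2 := by
  rw [ae_all_iff]
  intro i
  set c := ∫⁻ x, ‖x‖ₑ ∂(gaussianReal 0 1) with hcdef
  have hc : c < ∞ := by
    have : Integrable (id : ℝ → ℝ) (gaussianReal 0 1) := by
      have := memLp_id_gaussianReal (μ := 0) (v := 1) 1
      exact memLp_one_iff_integrable.1 (by exact_mod_cast this)
    exact this.2
  have hq : ∀ q, ∫⁻ ω, ‖ξ q ω‖ₑ ∂P = c := fun q => by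
    rw [hcdef, ← hξ_law q, lintegral_map (by fun_prop) (hξ_meas q)]
  have hG : ∀ k, ∫⁻ ω, ‖complexGaussian ξ i k ω‖ₑ ∂P ≤ 2 * c := by
    intro k
    calc ∫⁻ ω, ‖complexGaussian ξ i k ω‖ₑ ∂P ≤ ∫⁻ ω, (‖ξ (i, k, 0) ω‖ₑ + ‖ξ (i, k, 1) ω‖ₑ) ∂P := by
          refine lintegral_mono fun ω => ?_
          rw [← ofReal_norm, ← ofReal_norm, ← ofReal_norm,
            ← ENNReal.ofReal_add (norm_nonneg _) (norm_nonneg _)]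
          apply ENNReal.ofReal_le_ofReal
          rw [complexGaussian, norm_div, Complex.norm_real,
            Real.norm_of_nonneg (Real.sqrt_nonneg 2)]
          refine div_le_of_le_mul₀ (by positivity) (by positivity) ?_
          refine (norm_add_le _ _).trans ?_
          rw [norm_mul, Complex.norm_I, one_mul, Complex.norm_real, Complex.norm_real]
          exact le_mul_of_one_le_right (by positivity) (Real.one_le_sqrt.2 (by norm_num))
      _ = 2 * c := by
          rw [lintegral_add_left (hξ_meas _).enorm, hq, hq, two_mul]
  have hsum : ∑' k : ℕ, ENNReal.ofReal (1 / ((k : ℝ) + 1) ^ 2) < ∞ := by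
    have : Summable fun k : ℕ => 1 / ((k : ℝ) + 1) ^ 2 := by
      have := (summable_nat_add_iff 1).2 (Real.summable_one_div_nat_pow.2 one_lt_two)
      simpa using this
    exact this.tsum_ofReal_lt_top
  have hfin : ∫⁻ ω, ∑' k : ℕ, ENNReal.ofReal (1 / ((k : ℝ) + 1) ^ 2) *
      ‖complexGaussian ξ i k ω‖ₑ ∂P ≠ ∞ := by
    have hm : ∀ k, Measurable fun ω => ‖complexGaussian ξ i k ω‖ₑ := fun k =>
      (measurable_complexGaussian hξ_meas i k).enorm
    rw [lintegral_tsum fun k => ((hm k).const_mul _).aemeasurable]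
    refine ne_of_lt (lt_of_le_of_lt (ENNReal.tsum_le_tsum fun k => ?_)
      (b := ∑' k : ℕ, ENNReal.ofReal (1 / ((k : ℝ) + 1) ^ 2) * (2 * c)) ?_)
    · rw [lintegral_const_mul _ (hm k)]
      gcongr
      exact hG k
    · rw [ENNReal.tsum_mul_right]
      exact ENNReal.mul_lt_top hsum (ENNReal.mul_lt_top (by simp) hc)
  have hmeas : Measurable fun ω => ∑' k : ℕ, ENNReal.ofReal (1 / ((k : ℝ) + 1) ^ 2) *
      ‖complexGaussian ξ i k ω‖ₑ :=
    Measurable.tsum fun k => (measurable_complexGaussian hξ_meas i k).enorm.const_mul _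
  filter_upwards [ae_lt_top hmeas hfin] with ω hω
  refine ⟨(∑' k : ℕ, ENNReal.ofReal (1 / ((k : ℝ) + 1) ^ 2) *
      ‖complexGaussian ξ i k ω‖ₑ).toReal, fun k => ?_⟩
  have h1 := ENNReal.toReal_mono hω.ne (ENNReal.le_tsum (f := fun k : ℕ =>
    ENNReal.ofReal (1 / ((k : ℝ) + 1) ^ 2) * ‖complexGaussian ξ i k ω‖ₑ) k)
  rw [ENNReal.toReal_mul, ENNReal.toReal_ofReal (by positivity), toReal_enorm] at h1
  rw [one_div, inv_mul_le_iff₀ (by positivity)] at h1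
  linarith

end

/-! ### Moments of the growth constant -/

section

variable {U : Type*} {d : ℕ}

/-- The partial sums of `Γ'`. -/
noncomputable def partialDeriv (α : ℝ) (ξ : Fin d × ℕ × Fin 2 → U → ℝ) (i : Fin d) (n : ℕ) (ω : U)
    (z : ℂ) : ℂ :=
  ∑ k ∈ Finset.range n, basisFun α k z * complexGaussian ξ i k ω

variable [MeasurableSpace U] {P : Measure U} {ξ : Fin d × ℕ × Fin 2 → U → ℝ}

theorem measurable_basisFun (α : ℝ) (k : ℕ) : Measurable (basisFun α k) := by
  unfold basisFun; fun_prop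

theorem measurable_partialDeriv (α : ℝ) (hξ_meas : ∀ q, Measurable (ξ q)) (i : Fin d) (n : ℕ) :
    Measurable fun p : U × ℂ => partialDeriv α ξ i n p.1 p.2 := by
  unfold partialDeriv
  refine Finset.measurable_fun_sum _ fun k _ => Measurable.mul ?_ ?_
  · exact (measurable_basisFun α k).comp measurable_snd
  · exact (measurable_complexGaussian hξ_meas i k).comp measurable_fst

/-- The constant in the moment bound `E |Γ'_z|^{2m} ≤ C (Im z)^{(2α-2)m}`. -/
noncomputable def momentConst (α : ℝ) (m : ℕ) : ℝ :=
  2 ^ (m - 1) * (2 * ((2 * m).factorial * (2 * Real.exp (1 / 2)) * kernelConst α ^ m))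

/-- The real and imaginary parts of a partial sum are combinations of independent real Gaussians,
with variances bounded by the diagonal of the kernel. -/
theorem lintegral_partialDeriv_pow_le [IsProbabilityMeasure P] {α : ℝ}
    (hα : α ∈ Set.Ioo (0 : ℝ) (1 / 2)) (hξ_meas : ∀ q, Measurable (ξ q))
    (hξ_law : ∀ q, P.map (ξ q) = gaussianReal 0 1) (hξ_indep : iIndepFun ξ P)
    (i : Fin d) (n m : ℕ) {z : ℂ} (hz : z ∈ openUHP) :
    ∫⁻ ω, ‖partialDeriv α ξ i n ω z‖ₑ ^ (2 * m) ∂P ≤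
      ENNReal.ofReal (momentConst α m * z.im ^ (m * (2 * α - 2))) := by
  have hz0 : 0 < z.im := hz
  have hK := kernelConst_pos hα
  set V := kernelConst α * z.im ^ (2 * α - 2) with hV
  have hV0 : 0 < V := by positivity
  set ξ' : ℕ × Fin 2 → U → ℝ := fun q => ξ (i, q) with hξ'
  have hindep : iIndepFun ξ' P := hξ_indep.precomp (g := fun q : ℕ × Fin 2 => (i, q))
    (fun a b h => (Prod.ext_iff.1 h).2)
  set s : Finset (ℕ × Fin 2) := Finset.range n ×ˢ Finset.univ with hs
  set f : ℕ → ℂ := fun k => basisFun α k z with hf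
  set b : ℕ × Fin 2 → ℝ := fun q =>
    (if q.2 = 0 then (f q.1).re else -(f q.1).im) / Real.sqrt 2 with hb
  set b' : ℕ × Fin 2 → ℝ := fun q =>
    (if q.2 = 0 then (f q.1).im else (f q.1).re) / Real.sqrt 2 with hb'
  have hnf := sum_norm_basisFun_sq_le hα hz n
  have hnf' : ∑ k ∈ Finset.range n, ‖basisFun α k z‖ ^ 2 / 2 ≤ V := by
    rw [← Finset.sum_div]
    linarith
  have hbV : ∑ q ∈ s, b q ^ 2 ≤ V := by
    refine le_trans (le_of_eq ?_) hnf'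
    rw [hs, Finset.sum_product]
    refine Finset.sum_congr rfl fun k _ => ?_
    rw [Fin.sum_univ_two, ← Complex.normSq_eq_norm_sq, Complex.normSq_apply]
    simp [hb, div_pow, hf]; ring
  have hbV' : ∑ q ∈ s, b' q ^ 2 ≤ V := by
    refine le_trans (le_of_eq ?_) hnf'
    rw [hs, Finset.sum_product]
    refine Finset.sum_congr rfl fun k _ => ?_
    rw [Fin.sum_univ_two, ← Complex.normSq_eq_norm_sq, Complex.normSq_apply]
    simp [hb', div_pow, hf]; ring
  have hG : ∀ k ω, complexGaussian ξ i k ω =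
      ((ξ (i, k, 0) ω / Real.sqrt 2 : ℝ) : ℂ) +
        ((ξ (i, k, 1) ω / Real.sqrt 2 : ℝ) : ℂ) * Complex.I := by
    intro k ω
    rw [complexGaussian]; push_cast; ring
  have hre : ∀ ω, (partialDeriv α ξ i n ω z).re = ∑ q ∈ s, b q * ξ' q ω := by
    intro ω
    rw [partialDeriv, Complex.re_sum, hs, Finset.sum_product]
    refine Finset.sum_congr rfl fun k _ => ?_
    rw [Fin.sum_univ_two, hG]
    simp only [Complex.mul_re, Complex.add_re, Complex.add_im, Complex.ofReal_re, Complex.ofReal_im,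
      Complex.I_re, Complex.I_im, Complex.mul_im, hb, hf, hξ']
    simp; ring
  have him : ∀ ω, (partialDeriv α ξ i n ω z).im = ∑ q ∈ s, b' q * ξ' q ω := by
    intro ω
    rw [partialDeriv, Complex.im_sum, hs, Finset.sum_product]
    refine Finset.sum_congr rfl fun k _ => ?_
    rw [Fin.sum_univ_two, hG]
    simp only [Complex.mul_re, Complex.add_re, Complex.add_im, Complex.ofReal_re, Complex.ofReal_im,
      Complex.I_re, Complex.I_im, Complex.mul_im, hb', hf, hξ']
    simp; ring
  have hpt : ∀ ω, ‖partialDeriv α ξ i n ω z‖ₑ ^ (2 * m) ≤ ENNReal.ofReal (2 ^ (m - 1)) *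
      (ENNReal.ofReal ((∑ q ∈ s, b q * ξ' q ω) ^ (2 * m)) +
        ENNReal.ofReal ((∑ q ∈ s, b' q * ξ' q ω) ^ (2 * m))) := by
    intro ω
    rw [← hre, ← him, ← ofReal_norm, ← ENNReal.ofReal_pow (norm_nonneg _),
      ← ENNReal.ofReal_add ((even_two_mul m).pow_nonneg _) ((even_two_mul m).pow_nonneg _),
      ← ENNReal.ofReal_mul (by positivity)]
    apply ENNReal.ofReal_le_ofReal
    rw [pow_mul, ← Complex.normSq_eq_norm_sq, Complex.normSq_apply, ← pow_two, ← pow_two,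
      pow_mul, pow_mul]
    exact add_pow_le (sq_nonneg _) (sq_nonneg _) m
  have hm : ∀ c : ℕ × Fin 2 → ℝ, Measurable fun ω =>
      ENNReal.ofReal ((∑ q ∈ s, c q * ξ' q ω) ^ (2 * m)) := fun c =>
    ENNReal.measurable_ofReal.comp
      ((Finset.measurable_fun_sum _ fun q _ => (hξ_meas (i, q)).const_mul _).pow_const _)
  have g1 := lintegral_sum_gaussian_pow_le (fun q => hξ_meas (i, q)) (fun q => hξ_law (i, q))
    hindep s b hV0 hbV m
  have g2 := lintegral_sum_gaussian_pow_le (fun q => hξ_meas (i, q)) (fun q => hξ_law (i, q))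
    hindep s b' hV0 hbV' m
  have hm2 : Measurable fun ω => ENNReal.ofReal ((∑ q ∈ s, b q * ξ' q ω) ^ (2 * m)) +
      ENNReal.ofReal ((∑ q ∈ s, b' q * ξ' q ω) ^ (2 * m)) := (hm b).add (hm b')
  calc _ ≤ ∫⁻ ω, ENNReal.ofReal (2 ^ (m - 1)) *
      (ENNReal.ofReal ((∑ q ∈ s, b q * ξ' q ω) ^ (2 * m)) +
        ENNReal.ofReal ((∑ q ∈ s, b' q * ξ' q ω) ^ (2 * m))) ∂P := lintegral_mono hpt
    _ ≤ ENNReal.ofReal (2 ^ (m - 1)) *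
      (ENNReal.ofReal ((2 * m).factorial * (2 * Real.exp (1 / 2)) * V ^ m) +
        ENNReal.ofReal ((2 * m).factorial * (2 * Real.exp (1 / 2)) * V ^ m)) := by
        rw [lintegral_const_mul _ hm2, lintegral_add_left (hm b)]
        gcongr
    _ = _ := by
        rw [← ENNReal.ofReal_add (by positivity) (by positivity),
          ← ENNReal.ofReal_mul (by positivity)]
        congr 1
        rw [hV, mul_pow, ← Real.rpow_mul_natCast hz0.le, momentConst, mul_comm (2 * α - 2)]
        ring

/-- The sum over the coordinates of the weighted Bergman integrals
`∫ (Im z)^κ |Γ'_z(i)|^{2m} dz` over a half-disc. The power of `|Γ'|` is written as a lower limit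
of powers of partial sums, which is measurable in `(ω, z)`. -/
noncomputable def bergman (α : ℝ) (ξ : Fin d × ℕ × Fin 2 → U → ℝ) (R κ : ℝ) (m : ℕ) (ω : U) :
    ℝ≥0∞ :=
  ∑ i, ∫⁻ z in openUHP ∩ Metric.closedBall 0 R, ENNReal.ofReal (z.im ^ κ) *
    liminf (fun n => ‖partialDeriv α ξ i n ω z‖ₑ ^ (2 * m)) atTop

theorem measurable_bergman_integrand (α : ℝ) (hξ_meas : ∀ q, Measurable (ξ q)) (κ : ℝ) (m : ℕ)
    (i : Fin d) :
    Measurable fun p : U × ℂ => ENNReal.ofReal (p.2.im ^ κ) *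
      liminf (fun n => ‖partialDeriv α ξ i n p.1 p.2‖ₑ ^ (2 * m)) atTop := by
  refine Measurable.mul ?_ (Measurable.liminf fun n =>
    (measurable_partialDeriv α hξ_meas i n).enorm.pow_const _)
  exact ENNReal.measurable_ofReal.comp
    ((Complex.measurable_im.comp measurable_snd).pow_const κ)

theorem measurable_bergman (α : ℝ) (hξ_meas : ∀ q, Measurable (ξ q)) (R κ : ℝ) (m : ℕ) :
    Measurable (bergman α ξ R κ m) :=
  Finset.measurable_fun_sum _ fun i _ =>
    (measurable_bergman_integrand α hξ_meas κ m i).lintegral_prod_right'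

/-- By Tonelli and Fatou, the expectation is at most a multiple of the integral of
`(Im z)^{κ + m(2α-2)}` over a half-disc, where this power is bounded. -/
theorem lintegral_bergman_lt_top [IsProbabilityMeasure P] {α : ℝ}
    (hα : α ∈ Set.Ioo (0 : ℝ) (1 / 2)) (hξ_meas : ∀ q, Measurable (ξ q))
    (hξ_law : ∀ q, P.map (ξ q) = gaussianReal 0 1) (hξ_indep : iIndepFun ξ P)
    (R κ : ℝ) (m : ℕ) (hκ : 0 ≤ κ + m * (2 * α - 2)) :
    ∫⁻ ω, bergman α ξ R κ m ω ∂P < ∞ := by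
  have hmeas := measurable_bergman_integrand (ξ := ξ) α hξ_meas κ m
  have hK := kernelConst_pos hα
  have hC : 0 ≤ momentConst α m := by unfold momentConst; positivity
  unfold bergman
  rw [lintegral_finsetSum _ fun i _ => (hmeas i).lintegral_prod_right']
  refine ENNReal.sum_lt_top.2 fun i _ => ?_
  set D := openUHP ∩ Metric.closedBall (0 : ℂ) R with hD
  have hDm : MeasurableSet D :=
    isOpen_openUHP.measurableSet.inter Metric.isClosed_closedBall.measurableSet
  rw [lintegral_lintegral_swap (hmeas i).aemeasurable]
  calc _ ≤ ∫⁻ z in D, ENNReal.ofReal (momentConst α m * R ^ (κ + m * (2 * α - 2))) := by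
        refine setLIntegral_mono' hDm fun z hz => ?_
        have hz0 : 0 < z.im := hz.1
        have hzR : z.im ≤ R := ((le_abs_self _).trans (Complex.abs_im_le_norm z)).trans
          (mem_closedBall_zero_iff.1 hz.2)
        have hS : ∀ n, Measurable fun ω => ‖partialDeriv α ξ i n ω z‖ₑ ^ (2 * m) := fun n =>
          ((measurable_partialDeriv α hξ_meas i n).comp measurable_prodMk_right).enorm.pow_const _
        dsimp only
        rw [lintegral_const_mul _ (Measurable.liminf hS)]
        calc _ ≤ ENNReal.ofReal (z.im ^ κ) *
              ENNReal.ofReal (momentConst α m * z.im ^ (m * (2 * α - 2))) := by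
              gcongr
              refine (lintegral_liminf_le hS).trans ?_
              refine liminf_le_of_frequently_le' (Frequently.of_forall fun n => ?_)
              exact lintegral_partialDeriv_pow_le hα hξ_meas hξ_law hξ_indep i n m hz.1
          _ = ENNReal.ofReal (momentConst α m * z.im ^ (κ + m * (2 * α - 2))) := by
              rw [← ENNReal.ofReal_mul (by positivity), Real.rpow_add hz0]
              congr 1; ring
          _ ≤ _ := by
              apply ENNReal.ofReal_le_ofReal
              gcongr
    _ < ∞ := by
        rw [setLIntegral_const]
        exact ENNReal.mul_lt_top ENNReal.ofReal_lt_top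
          ((measure_mono Set.inter_subset_right).trans_lt measure_closedBall_lt_top)

/-- A holomorphic function is controlled by its weighted Bergman integral, through the mean value
inequality over the disc of centre `z` and radius `Im z / 2`. -/
theorem norm_pow_le_of_bergman {F : ℂ → ℂ} (hF : DifferentiableOn ℂ F openUHP) {R κ : ℝ}
    (hκ : 0 ≤ κ) (m : ℕ) {Y : ℝ≥0∞} (hY : Y ≠ ∞)
    (hFY : ∫⁻ z in openUHP ∩ Metric.closedBall 0 (2 * R),
      ENNReal.ofReal (z.im ^ κ) * ‖F z‖ₑ ^ (2 * m) ≤ Y) {z : ℂ} (hz : 0 < z.im) (hzR : ‖z‖ ≤ R) :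
    ‖F z‖ ^ (2 * m) * z.im ^ (κ + 2) ≤ 2 ^ (κ + 2) * Y.toReal := by
  set y := z.im with hy
  have hyz : y ≤ ‖z‖ := (le_abs_self _).trans (Complex.abs_im_le_norm z)
  have him : ∀ u ∈ Metric.ball z (y / 2), y / 2 ≤ u.im := by
    intro u hu
    have h1 : |(u - z).im| ≤ ‖u - z‖ := Complex.abs_im_le_norm _
    have h2 := mem_ball_iff_norm.1 hu
    rw [Complex.sub_im] at h1
    have := neg_abs_le (u.im - z.im)
    linarith
  have hsub : Metric.ball z (y / 2) ⊆ openUHP ∩ Metric.closedBall 0 (2 * R) := by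
    intro u hu
    refine ⟨lt_of_lt_of_le (by positivity) (him u hu), mem_closedBall_zero_iff.2 ?_⟩
    have h2 := mem_ball_iff_norm.1 hu
    have h3 : ‖u‖ ≤ ‖u - z‖ + ‖z‖ := by simpa using norm_add_le (u - z) z
    linarith
  have hmv := enorm_mul_le_lintegral_ball (f := fun u => F u ^ (2 * m)) (c := z)
    (r := y / 2) (by positivity) ((hF.mono fun u hu => (hsub hu).1).pow _)
  simp only [enorm_pow] at hmv
  have key : ENNReal.ofReal ((y / 2) ^ κ) * (‖F z‖ₑ ^ (2 * m) *
      ENNReal.ofReal (Real.pi * (y / 2) ^ 2)) ≤ Y := by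
    calc _ ≤ ENNReal.ofReal ((y / 2) ^ κ) * ∫⁻ u in Metric.ball z (y / 2), ‖F u‖ₑ ^ (2 * m) := by
          gcongr
      _ = ∫⁻ u in Metric.ball z (y / 2), ENNReal.ofReal ((y / 2) ^ κ) * ‖F u‖ₑ ^ (2 * m) := by
          rw [lintegral_const_mul' _ _ ENNReal.ofReal_ne_top]
      _ ≤ ∫⁻ u in Metric.ball z (y / 2), ENNReal.ofReal (u.im ^ κ) * ‖F u‖ₑ ^ (2 * m) := by
          refine setLIntegral_mono' Metric.isOpen_ball.measurableSet fun u hu => ?_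
          gcongr
          exact him u hu
      _ ≤ _ := (lintegral_mono_set hsub).trans hFY
  rw [← ofReal_norm, ← ENNReal.ofReal_pow (norm_nonneg _), ← ENNReal.ofReal_mul (by positivity),
    ← ENNReal.ofReal_mul (by positivity), ENNReal.ofReal_le_iff_le_toReal hY] at key
  have e : (y / 2) ^ κ * (‖F z‖ ^ (2 * m) * (Real.pi * (y / 2) ^ 2)) =
      Real.pi * (‖F z‖ ^ (2 * m) * y ^ (κ + 2)) / 2 ^ (κ + 2) := by
    rw [Real.div_rpow hz.le (by norm_num), Real.rpow_add hz,
      Real.rpow_add (by norm_num : (0 : ℝ) < 2)]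
    simp only [Real.rpow_ofNat]
    field_simp
  rw [e, div_le_iff₀ (by positivity)] at key
  have : 1 ≤ Real.pi := by linarith [Real.pi_gt_three]
  have h0 : 0 ≤ ‖F z‖ ^ (2 * m) * y ^ (κ + 2) := by positivity
  nlinarith

/-- All moments of the supremum over a half-disc of `(Im z)^{1-β} |Γ'_z|` are finite when
`β < α`. -/
theorem exists_growthBound [IsProbabilityMeasure P] {α β : ℝ}
    (hα : α ∈ Set.Ioo (0 : ℝ) (1 / 2)) (hβα : β < α)
    (hξ_meas : ∀ q, Measurable (ξ q))
    (hξ_law : ∀ q, P.map (ξ q) = gaussianReal 0 1) (hξ_indep : iIndepFun ξ P)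
    (R p : ℝ) (hp : 1 ≤ p) :
    ∃ N : U → ℝ, (∀ ω, 1 ≤ N ω) ∧
      ∫⁻ ω, ENNReal.ofReal (N ω ^ (2 * p)) ∂P < ∞ ∧
      ∀ᵐ ω ∂P, ∀ i, GrowthBound β R (N ω) fun z => gammaDeriv α ξ ω z i := by
  obtain ⟨m, hm⟩ := exists_nat_ge (max p (1 / (α - β)))
  have hmp : p ≤ m := (le_max_left _ _).trans hm
  have hmβ : 1 ≤ m * (α - β) := (div_le_iff₀ (by linarith)).1 ((le_max_right _ _).trans hm)
  have hm0 : (0 : ℝ) < m := by linarith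
  -- The mean value inequality costs a factor `y⁻²`, and `E |Γ'_z|^{2m} ≲ y^{(2α-2)m}`: with this
  -- `κ` the expected integrand is `O(y^{2m(α-β)-2})`, which the choice of `m` keeps bounded.
  set κ : ℝ := 2 * m * (1 - β) - 2 with hκ
  have hκ1 : 0 ≤ κ + m * (2 * α - 2) := by
    rw [hκ]; linarith
  have hκ0 : 0 ≤ κ := by
    have : 0 ≤ (m : ℝ) * (2 - 2 * α) := mul_nonneg hm0.le (by linarith [hα.2])
    linarith
  set Y := bergman α ξ (2 * R) κ m with hYdef
  have hYm : Measurable Y := measurable_bergman α hξ_meas _ _ _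
  have hYi : ∫⁻ ω, Y ω ∂P < ∞ := lintegral_bergman_lt_top hα hξ_meas hξ_law hξ_indep _ _ _ hκ1
  set Z : U → ℝ := fun ω => 1 + 2 ^ (κ + 2) * (Y ω).toReal with hZ
  have hZ1 : ∀ ω, 1 ≤ Z ω := fun ω => by
    have : 0 ≤ (2 : ℝ) ^ (κ + 2) * (Y ω).toReal := by positivity
    simp only [hZ]; linarith
  refine ⟨fun ω => Z ω ^ (1 / (2 * m) : ℝ),
    fun ω => Real.one_le_rpow (hZ1 ω) (by positivity), ?_, ?_⟩
  · calc _ ≤ ∫⁻ ω, (1 + ENNReal.ofReal (2 ^ (κ + 2)) * Y ω) ∂P := by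
          refine lintegral_mono fun ω => ?_
          have h1 : (Z ω ^ (1 / (2 * m) : ℝ)) ^ (2 * p) ≤ Z ω := by
            rw [← Real.rpow_mul (by linarith [hZ1 ω])]
            conv_rhs => rw [← Real.rpow_one (Z ω)]
            refine Real.rpow_le_rpow_of_exponent_le (hZ1 ω) ?_
            rw [one_div_mul_eq_div, div_le_one (by positivity)]
            linarith
          refine (ENNReal.ofReal_le_ofReal h1).trans ?_
          simp only [hZ]
          rw [ENNReal.ofReal_add zero_le_one (by positivity), ENNReal.ofReal_one,
            ENNReal.ofReal_mul (by positivity)]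
          gcongr
          exact ENNReal.ofReal_toReal_le
      _ < ∞ := by
          rw [lintegral_add_left measurable_const, lintegral_const_mul _ hYm]
          exact ENNReal.add_lt_top.2 ⟨by simp, ENNReal.mul_lt_top ENNReal.ofReal_lt_top hYi⟩
  · filter_upwards [ae_complexGaussian_le hξ_meas hξ_law, ae_lt_top hYm hYi.ne] with ω hω hYω
    intro i z hz hzR
    obtain ⟨M, hM⟩ := hω i
    obtain ⟨hsum, hdiff⟩ := hasSum_gammaDeriv hα hM
    have hFY : ∫⁻ z in openUHP ∩ Metric.closedBall 0 (2 * R),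
        ENNReal.ofReal (z.im ^ κ) * ‖gammaDeriv α ξ ω z i‖ₑ ^ (2 * m) ≤ Y ω := by
      refine le_trans (le_of_eq ?_) (Finset.single_le_sum (f := fun i =>
        ∫⁻ z in openUHP ∩ Metric.closedBall 0 (2 * R), ENNReal.ofReal (z.im ^ κ) *
          liminf (fun n => ‖partialDeriv α ξ i n ω z‖ₑ ^ (2 * m)) atTop)
        (fun _ _ => zero_le) (Finset.mem_univ i))
      refine setLIntegral_congr_fun
        (isOpen_openUHP.measurableSet.inter Metric.isClosed_closedBall.measurableSet)
        fun z hz => ?_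
      have ht : Tendsto (fun n => ‖partialDeriv α ξ i n ω z‖ₑ ^ (2 * m)) atTop
          (𝓝 (‖gammaDeriv α ξ ω z i‖ₑ ^ (2 * m))) :=
        ((ENNReal.continuous_pow (2 * m)).tendsto _).comp
          ((continuous_enorm.tendsto _).comp (hsum z hz.1).tendsto_sum_nat)
      rw [ht.liminf_eq]
    have key := norm_pow_le_of_bergman hdiff hκ0 m hYω.ne hFY hz hzR
    set a := ‖gammaDeriv α ξ ω z i‖ with ha
    have ha0 : 0 ≤ a := norm_nonneg _
    have hpow : (a * z.im ^ (1 - β)) ^ (2 * m : ℝ) ≤ Z ω := by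
      rw [Real.mul_rpow ha0 (by positivity), ← Real.rpow_mul hz.le]
      have e1 : a ^ (2 * m : ℝ) = a ^ (2 * m) := by
        rw [← Real.rpow_natCast]; push_cast; rfl
      have e2 : (1 - β) * (2 * m) = κ + 2 := by rw [hκ]; ring
      rw [e1, e2]
      simp only [hZ]; linarith
    have h1 : a * z.im ^ (1 - β) ≤ Z ω ^ (1 / (2 * m) : ℝ) := by
      rw [one_div]
      exact (Real.le_rpow_inv_iff_of_pos (by positivity) (by linarith [hZ1 ω])
        (by positivity)).2 hpow
    calc a = (a * z.im ^ (1 - β)) * z.im ^ (β - 1) := by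
          rw [mul_assoc, ← Real.rpow_add hz]; simp
      _ ≤ _ := by gcongr

end

/-! ### Measurability and almost sure structure -/

section Separability

variable {V : Type*} [NormedAddCommGroup V]

theorem holderNorm₂_congr {μ : ℝ} {Ω : Set ℂ} {h k : ℂ → ℂ → V}
    (hk : ∀ t ∈ Ω, ∀ s ∈ Ω, h t s = k t s) : holderNorm₂ μ Ω h = holderNorm₂ μ Ω k :=
  biSup_congr fun t ht => biSup_congr fun s hs => by rw [hk t ht s hs]

theorem multiNorm₂_congr {β : ℝ} {Ω : Set ℂ} (hΩ : Ω ⊆ closedUHP) {h k : ℂ → ℂ → V}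
    (hk : ∀ t ∈ closedUHP, ∀ s ∈ closedUHP, h t s = k t s) :
    multiNorm₂ β Ω h = multiNorm₂ β Ω k :=
  biSup_congr fun ε hε => biSup_congr fun t ht => biSup_congr fun s hs => by
    rw [hk t (hΩ ht) s (hΩ hs),
      hk _ (add_mem_closedUHP (hΩ ht) hε.1) _ (add_mem_closedUHP (hΩ hs) hε.1)]

theorem pairNorm_congr {d : ℕ} {γ : ℝ} {Ω : Set ℂ} {g k : ℂ → Fin d → ℂ}
    {h l : ℂ → ℂ → Fin d → Fin d → ℂ} (hg : ∀ t ∈ Ω, g t = k t)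
    (hh : ∀ t ∈ Ω, ∀ s ∈ Ω, h t s = l t s) : pairNorm γ Ω g h = pairNorm γ Ω k l := by
  have h1 : holderNorm₂ γ Ω (delta₁ g) = holderNorm₂ γ Ω (delta₁ k) :=
    holderNorm₂_congr fun t ht s hs => by rw [delta₁, delta₁, hg t ht, hg s hs]
  have h2 : (⨆ t ∈ Ω, ‖g t‖ₑ) = ⨆ t ∈ Ω, ‖k t‖ₑ := biSup_congr fun t ht => by rw [hg t ht]
  rw [pairNorm, pairNorm, holderNorm₁, holderNorm₁, h1, h2, holderNorm₂_congr hh]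

theorem iSup_enorm_eq_of_dense {Ω D : Set ℂ} (hD : D ⊆ Ω) (hΩ : Ω ⊆ closure D) {g : ℂ → V}
    (hg : ContinuousOn g Ω) : ⨆ t ∈ Ω, ‖g t‖ₑ = ⨆ t ∈ D, ‖g t‖ₑ := by
  refine le_antisymm (iSup₂_le fun t ht => ?_) (biSup_mono fun t ht => hD ht)
  have : (𝓝[D] t).NeBot := mem_closure_iff_nhdsWithin_neBot.1 (hΩ ht)
  have hc : Tendsto (fun x => ‖g x‖ₑ) (𝓝[D] t) (𝓝 ‖g t‖ₑ) :=
    (continuous_enorm.tendsto _).comp ((hg t ht).mono hD)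
  refine le_of_tendsto hc ?_
  filter_upwards [self_mem_nhdsWithin] with x hx using le_iSup₂_of_le x hx le_rfl

/-- The quotient is continuous off the diagonal and vanishes on it, so that the supremum over a
dense subset suffices. -/
theorem holderNorm₂_eq_of_dense {μ : ℝ} {Ω D : Set ℂ} (hD : D ⊆ Ω) (hΩ : Ω ⊆ closure D)
    {h : ℂ → ℂ → V} (hh : ContinuousOn (Function.uncurry h) (Ω ×ˢ Ω)) (hdiag : ∀ t ∈ Ω, h t t = 0) :
    holderNorm₂ μ Ω h = holderNorm₂ μ D h := by
  refine le_antisymm (iSup₂_le fun t ht => iSup₂_le fun s hs => ?_)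
    ((biSup_mono fun t ht => hD ht).trans (iSup₂_mono fun t ht => biSup_mono fun s hs => hD hs))
  rcases eq_or_ne t s with rfl | hne
  · simp [hdiag t ht]
  have hmem : (t, s) ∈ closure (D ×ˢ D) := by
    rw [closure_prod_eq]; exact ⟨hΩ ht, hΩ hs⟩
  have : (𝓝[D ×ˢ D] (t, s)).NeBot := mem_closure_iff_nhdsWithin_neBot.1 hmem
  have hpos : ‖t - s‖ₑ ^ μ ≠ 0 := by
    have h0 : ‖t - s‖ₑ ≠ 0 := enorm_ne_zero.2 (sub_ne_zero.2 hne)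
    simp [ENNReal.rpow_eq_zero_iff, h0]
  have h1 : Tendsto (fun p : ℂ × ℂ => ‖h p.1 p.2‖ₑ) (𝓝[D ×ˢ D] (t, s)) (𝓝 ‖h t s‖ₑ) :=
    (continuous_enorm.tendsto _).comp ((hh (t, s) ⟨ht, hs⟩).mono (Set.prod_mono hD hD))
  have h2 : Tendsto (fun p : ℂ × ℂ => ‖p.1 - p.2‖ₑ ^ μ) (𝓝[D ×ˢ D] (t, s))
      (𝓝 (‖t - s‖ₑ ^ μ)) := by
    have hc : Continuous fun p : ℂ × ℂ => ‖p.1 - p.2‖ₑ ^ μ :=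
      ENNReal.continuous_rpow_const.comp (continuous_enorm.comp (by fun_prop))
    exact (hc.tendsto (t, s)).mono_left nhdsWithin_le_nhds
  refine le_of_tendsto (ENNReal.Tendsto.div h1 (Or.inr hpos) h2 (Or.inr enorm_ne_top)) ?_
  filter_upwards [self_mem_nhdsWithin] with p hp using
    le_iSup₂_of_le p.1 hp.1 (le_iSup₂_of_le p.2 hp.2 le_rfl)

end Separability

section Measurability

variable {U : Type*} [MeasurableSpace U] {P : Measure U} {d : ℕ}

theorem aemeasurable_pairNorm {γ : ℝ} {Ω : Set ℂ} {X : U → ℂ → Fin d → ℂ}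
    {A : U → ℂ → ℂ → Fin d → Fin d → ℂ} (hX : ∀ t ∈ Ω, AEMeasurable (fun ω => X ω t) P)
    (hA : ∀ t ∈ Ω, ∀ s ∈ Ω, AEMeasurable (fun ω => A ω t s) P)
    (hXc : ∀ᵐ ω ∂P, ContinuousOn (X ω) Ω)
    (hAc : ∀ᵐ ω ∂P, ContinuousOn (Function.uncurry (A ω)) (Ω ×ˢ Ω))
    (hAd : ∀ᵐ ω ∂P, ∀ t ∈ Ω, A ω t t = 0) :
    AEMeasurable (fun ω => pairNorm γ Ω (X ω) (A ω)) P := by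
  obtain ⟨D, hD, hDc, hΩ⟩ :=
    (TopologicalSpace.IsSeparable.of_separableSpace Ω).exists_countable_dense_subset
  have hm : AEMeasurable (fun ω => pairNorm γ D (X ω) (A ω)) P := by
    refine AEMeasurable.add (AEMeasurable.add ?_ ?_) ?_
    · exact AEMeasurable.biSup D hDc fun t ht => (hX t (hD ht)).enorm
    · exact AEMeasurable.biSup D hDc fun t ht => AEMeasurable.biSup D hDc fun s hs =>
        ((hX t (hD ht)).sub (hX s (hD hs))).enorm.div_const _
    · exact AEMeasurable.biSup D hDc fun t ht => AEMeasurable.biSup D hDc fun s hs =>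
        (hA t (hD ht) s (hD hs)).enorm.div_const _
  refine hm.congr ?_
  filter_upwards [hXc, hAc, hAd] with ω h1 h2 h3
  have hd : ContinuousOn (Function.uncurry (delta₁ (X ω))) (Ω ×ˢ Ω) :=
    (h1.comp continuousOn_fst fun p hp => hp.1).sub (h1.comp continuousOn_snd fun p hp => hp.2)
  rw [pairNorm, pairNorm, holderNorm₁, holderNorm₁, iSup_enorm_eq_of_dense hD hΩ h1,
    holderNorm₂_eq_of_dense hD hΩ hd (fun t _ => by simp [delta₁]),
    holderNorm₂_eq_of_dense hD hΩ h2 h3]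

/-- A random norm bounded by `C N²` inherits its `p`-th moment from the `2p`-th moment of `N`. -/
theorem lintegral_rpow_le {Q : U → ℝ≥0∞} {N : U → ℝ} (hN : ∀ ω, 1 ≤ N ω) {C p : ℝ} (hC : 0 ≤ C)
    (hp : 0 ≤ p) (hQ : ∀ᵐ ω ∂P, Q ω ≤ ENNReal.ofReal (C * N ω ^ 2)) :
    ∫⁻ ω, Q ω ^ p ∂P ≤ ENNReal.ofReal (C ^ p) * ∫⁻ ω, ENNReal.ofReal (N ω ^ (2 * p)) ∂P := by
  rw [← lintegral_const_mul' _ _ ENNReal.ofReal_ne_top]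
  refine lintegral_mono_ae ?_
  filter_upwards [hQ] with ω hω
  have h0 : 0 ≤ N ω := by linarith [hN ω]
  calc Q ω ^ p ≤ ENNReal.ofReal (C * N ω ^ 2) ^ p := by gcongr
    _ = _ := by
      rw [ENNReal.ofReal_rpow_of_nonneg (by positivity) hp, Real.mul_rpow hC (by positivity),
        ENNReal.ofReal_mul (by positivity), ← Real.rpow_natCast, ← Real.rpow_mul h0]
      norm_num

theorem inLp_of_le {p γ : ℝ} {Ω : Set ℂ} {X : U → ℂ → Fin d → ℂ}
    {A : U → ℂ → ℂ → Fin d → Fin d → ℂ} (hX : ∀ t ∈ Ω, AEMeasurable (fun ω => X ω t) P)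
    (hA : ∀ t ∈ Ω, ∀ s ∈ Ω, AEMeasurable (fun ω => A ω t s) P)
    (hXc : ∀ᵐ ω ∂P, ContinuousOn (X ω) Ω)
    (hAc : ∀ᵐ ω ∂P, ContinuousOn (Function.uncurry (A ω)) (Ω ×ˢ Ω))
    (hAd : ∀ᵐ ω ∂P, ∀ t ∈ Ω, A ω t t = 0)
    {N : U → ℝ} (hN : ∀ ω, 1 ≤ N ω) {C : ℝ} (hC : 0 ≤ C) (hp : 0 ≤ p)
    (hNp : ∫⁻ ω, ENNReal.ofReal (N ω ^ (2 * p)) ∂P < ∞)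
    (hQ : ∀ᵐ ω ∂P, pairNorm γ Ω (X ω) (A ω) ≤ ENNReal.ofReal (C * N ω ^ 2)) :
    InLp P p γ Ω X A :=
  ⟨hX, hA, aemeasurable_pairNorm hX hA hXc hAc hAd,
    (lintegral_rpow_le hN hC hp hQ).trans_lt (ENNReal.mul_lt_top ENNReal.ofReal_lt_top hNp)⟩

theorem measurable_segIntegral {f : U → ℂ → ℂ} (hf : Measurable fun p : U × ℂ => f p.1 p.2) :
    Measurable fun q : U × ℂ × ℂ => segIntegral (f q.1) q.2.1 q.2.2 := by
  unfold segIntegral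
  simp_rw [intervalIntegral.integral_of_le zero_le_one]
  refine Measurable.mul (by fun_prop) ?_
  have : Measurable fun x : (U × ℂ × ℂ) × ℝ =>
      f x.1.1 (x.1.2.1 + (x.2 : ℂ) * (x.1.2.2 - x.1.2.1)) :=
    hf.comp (by fun_prop : Measurable fun x : (U × ℂ × ℂ) × ℝ =>
      (x.1.1, x.1.2.1 + (x.2 : ℂ) * (x.1.2.2 - x.1.2.1)))
  exact (this.stronglyMeasurable.integral_prod_right').measurable

variable {ξ : Fin d × ℕ × Fin 2 → U → ℝ}

theorem measurable_gammaDeriv (α : ℝ) (hξ_meas : ∀ q, Measurable (ξ q)) (i : Fin d) :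
    Measurable fun p : U × ℂ => gammaDeriv α ξ p.1 p.2 i := by
  unfold gammaDeriv
  refine Measurable.tsum fun k => Measurable.mul ?_ ?_
  · exact (measurable_basisFun α k).comp measurable_snd
  · exact (measurable_complexGaussian hξ_meas i k).comp measurable_fst

theorem measurable_segIntegral_gammaDeriv (α : ℝ) (hξ_meas : ∀ q, Measurable (ξ q)) (i : Fin d)
    (z : ℂ) : Measurable fun ω => segIntegral (fun u => gammaDeriv α ξ ω u i) 0 z :=
  (measurable_segIntegral (f := fun ω u => gammaDeriv α ξ ω u i)
    (measurable_gammaDeriv α hξ_meas i)).comp (by fun_prop :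
    Measurable fun ω : U => (ω, (0 : ℂ), z))

theorem measurable_shift {f : U → ℂ → ℂ} (hf : Measurable fun p : U × ℂ => f p.1 p.2) (w : ℂ) :
    Measurable fun p : U × ℂ => f p.1 (p.2 + w) :=
  hf.comp (by fun_prop : Measurable fun p : U × ℂ => (p.1, p.2 + w))

theorem measurable_segIntegral_segIntegral {f g : U → ℂ → ℂ}
    (hf : Measurable fun p : U × ℂ => f p.1 p.2) (hg : Measurable fun p : U × ℂ => g p.1 p.2)
    (t s : ℂ) : Measurable fun ω => segIntegral (fun u => f ω u * segIntegral (g ω) s u) s t := by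
  have hin : Measurable fun p : U × ℂ => segIntegral (g p.1) s p.2 :=
    (measurable_segIntegral hg).comp (by fun_prop : Measurable fun p : U × ℂ => (p.1, s, p.2))
  exact (measurable_segIntegral (f := fun ω u => f ω u * segIntegral (g ω) s u)
    (hf.mul hin)).comp (by fun_prop : Measurable fun ω : U => (ω, s, t))

theorem measurable_levyApprox (α : ℝ) (hξ_meas : ∀ q, Measurable (ξ q)) (ε : ℝ) (t s : ℂ) :
    Measurable fun ω => levyApprox α ξ ε ω t s := by
  refine measurable_pi_iff.2 fun i => measurable_pi_iff.2 fun j => ?_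
  have hsh := fun k => measurable_shift (f := fun ω u => gammaDeriv α ξ ω u k)
    (measurable_gammaDeriv α hξ_meas k) (Complex.I * ε)
  exact measurable_segIntegral_segIntegral
    (f := fun ω u => gammaDeriv α ξ ω (u + Complex.I * ε) i)
    (g := fun ω u => gammaDeriv α ξ ω (u + Complex.I * ε) j) (hsh i) (hsh j) t s

/-- The Lévy area, the limit of the regularized areas (a junk value where the limit does not
exist). -/
noncomputable def levyArea (α : ℝ) (ξ : Fin d × ℕ × Fin 2 → U → ℝ) (ω : U) (t s : ℂ) :
    Fin d → Fin d → ℂ := fun i j =>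
  limUnder (𝓝[>] (0 : ℝ)) fun ε => levyApprox α ξ ε ω t s i j

/-- Almost surely, `Γ` is a Hölder continuous primitive of `Γ'` and the Lévy areas are given by
primitives of the products `Γ'(i) Γ(j)`. -/
theorem ae_isLift [IsProbabilityMeasure P] {α : ℝ} (hα : α ∈ Set.Ioo (0 : ℝ) (1 / 2))
    (hξ_meas : ∀ q, Measurable (ξ q)) (hξ_law : ∀ q, P.map (ξ q) = gaussianReal 0 1)
    (hξ_indep : iIndepFun ξ P) :
    ∀ᵐ ω ∂P, ∃ H : Fin d → Fin d → ℂ → ℂ,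
      IsLift (fun i z => gammaDeriv α ξ ω z i) (gamma α ξ ω) H ∧
      (∀ t ∈ closedUHP, ∀ s ∈ closedUHP, levyArea α ξ ω t s = areaMatrix H (gamma α ξ ω) t s) ∧
      ∀ ε : ℝ, 0 < ε → ∀ t ∈ closedUHP, ∀ s ∈ closedUHP, levyApprox α ξ ε ω t s =
        areaMatrix H (gamma α ξ ω) (t + Complex.I * ε) (s + Complex.I * ε) := by
  obtain ⟨hα0, hα1⟩ := hα
  set β := α / 2 with hβ
  have hβ0 : 0 < β := by positivity
  have hβ1 : β ≤ 1 := by linarith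
  have hgrowth : ∀ᵐ ω ∂P, ∀ n : ℕ, ∃ N : ℝ, 0 ≤ N ∧
      ∀ i, GrowthBound β n N fun z => gammaDeriv α ξ ω z i := by
    rw [ae_all_iff]
    intro n
    obtain ⟨N, hN1, -, hN⟩ := exists_growthBound (β := β) ⟨hα0, hα1⟩ (by linarith) hξ_meas
      hξ_law hξ_indep n 1 le_rfl
    filter_upwards [hN] with ω hω using ⟨N ω, by linarith [hN1 ω], hω⟩
  filter_upwards [hgrowth, ae_complexGaussian_le hξ_meas hξ_law] with ω hω hcoef
  have hF : ∀ i, DifferentiableOn ℂ (fun z => gammaDeriv α ξ ω z i) openUHP := fun i =>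
    let ⟨_, hM⟩ := hcoef i
    (hasSum_gammaDeriv ⟨hα0, hα1⟩ hM).2
  have hN : ∀ R, ∃ N : ℝ, 0 ≤ N ∧ ∀ i, GrowthBound β R N fun z => gammaDeriv α ξ ω z i := by
    intro R
    obtain ⟨n, hn⟩ := exists_nat_ge R
    obtain ⟨N, hN0, hNb⟩ := hω n
    exact ⟨N, hN0, fun i => (hNb i).mono hn⟩
  have hprim : ∀ i, IsPrimitive (fun z => gammaDeriv α ξ ω z i) (fun z => gamma α ξ ω z i) :=
    fun i => isPrimitive_pathOf hβ0 hβ1 (hF i) fun R =>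
      let ⟨N, hN0, hNb⟩ := hN R
      ⟨N, hN0, hNb i⟩
  have hH : ∀ i j, ∃ H : ℂ → ℂ,
      (∀ z ∈ openUHP, HasDerivAt H (gammaDeriv α ξ ω z i * gamma α ξ ω z j) z) ∧
        ContinuousOn H closedUHP := fun i j =>
    exists_primitive_mul hβ0 hβ1 (hprim i) (hprim j) (hF i) fun R =>
      let ⟨N, hN0, hNb⟩ := hN R
      ⟨N, hN0, hNb i, hNb j⟩
  choose H hHd hHc using hH
  have happ : ∀ ε : ℝ, 0 < ε → ∀ t ∈ closedUHP, ∀ s ∈ closedUHP, levyApprox α ξ ε ω t s =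
      areaMatrix H (gamma α ξ ω) (t + Complex.I * ε) (s + Complex.I * ε) := by
    intro ε hε t ht s hs
    ext i j
    exact segIntegral_segIntegral (hF i) (hF j) (hprim i) (hprim j) (hHd i j) hε ht hs
  refine ⟨H, ⟨hprim, hHd, hHc⟩, fun t ht s hs => ?_, happ⟩
  ext i j
  refine Tendsto.limUnder_eq ((tendsto_area (hHc i j) (hprim i).continuousOn
    (hprim j).continuousOn ht hs).congr' ?_)
  filter_upwards [self_mem_nhdsWithin] with ε hε
  rw [happ ε hε t ht s hs]; rfl

end Measurability

section

variable {d : ℕ} {F : Fin d → ℂ → ℂ} {g : ℂ → Fin d → ℂ} {H : Fin d → Fin d → ℂ → ℂ}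

theorem IsLift.continuousOn_path (hL : IsLift F g H) : ContinuousOn g closedUHP :=
  continuousOn_pi.2 fun i => (hL.isPrimitive i).continuousOn

theorem IsLift.continuousOn_areaMatrix (hL : IsLift F g H) :
    ContinuousOn (Function.uncurry (areaMatrix H g)) (closedUHP ×ˢ closedUHP) := by
  refine continuousOn_pi.2 fun i => continuousOn_pi.2 fun j => ?_
  have h1 : ∀ {f : ℂ → ℂ}, ContinuousOn f closedUHP →
      ContinuousOn (fun p : ℂ × ℂ => f p.1) (closedUHP ×ˢ closedUHP) := fun hf =>
    hf.comp continuousOn_fst fun p hp => hp.1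
  have h2 : ∀ {f : ℂ → ℂ}, ContinuousOn f closedUHP →
      ContinuousOn (fun p : ℂ × ℂ => f p.2) (closedUHP ×ˢ closedUHP) := fun hf =>
    hf.comp continuousOn_snd fun p hp => hp.2
  have hi := (hL.isPrimitive i).continuousOn
  have hj := (hL.isPrimitive j).continuousOn
  exact ((h1 (hL.continuousOn i j)).sub (h2 (hL.continuousOn i j))).sub
    (((h1 hi).sub (h2 hi)).mul (h2 hj))

theorem areaMatrix_self (H : Fin d → Fin d → ℂ → ℂ) (g : ℂ → Fin d → ℂ) (t : ℂ) :
    areaMatrix H g t t = 0 := by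
  ext i j; simp [areaMatrix, area]

theorem IsLift.continuousOn_path_shift (hL : IsLift F g H) {ε : ℝ} (hε : 0 ≤ ε) :
    ContinuousOn (fun t => g (t + Complex.I * ε)) closedUHP :=
  hL.continuousOn_path.comp (by fun_prop) fun _ hz => add_mem_closedUHP hz hε

theorem IsLift.continuousOn_areaMatrix_shift (hL : IsLift F g H) {ε : ℝ} (hε : 0 ≤ ε) :
    ContinuousOn (fun p : ℂ × ℂ => areaMatrix H g (p.1 + Complex.I * ε) (p.2 + Complex.I * ε))
      (closedUHP ×ˢ closedUHP) :=
  hL.continuousOn_areaMatrix.comp (f := fun p : ℂ × ℂ =>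
    (p.1 + Complex.I * (ε : ℂ), p.2 + Complex.I * (ε : ℂ))) (by fun_prop)
    fun _ hp => ⟨add_mem_closedUHP hp.1 hε, add_mem_closedUHP hp.2 hε⟩

end

/-! ### Convergence and properties of the Lévy area -/

section

variable {U : Type*} [MeasurableSpace U] {P : Measure U} [IsProbabilityMeasure P] {d : ℕ}
  {ξ : Fin d × ℕ × Fin 2 → U → ℝ} {α : ℝ} (hα : α ∈ Set.Ioo (0 : ℝ) (1 / 2))
  (hξ_meas : ∀ q, Measurable (ξ q)) (hξ_law : ∀ q, P.map (ξ q) = gaussianReal 0 1)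
  (hξ_indep : iIndepFun ξ P)

include hα hξ_meas hξ_law hξ_indep

theorem aemeasurable_gamma {z : ℂ} (hz : z ∈ closedUHP) :
    AEMeasurable (fun ω => gamma α ξ ω z) P := by
  refine aemeasurable_pi_iff.2 fun i => ?_
  refine aemeasurable_of_tendsto_metrizable_ae (𝓝[>] (0 : ℝ)) (f := fun (ε : ℝ) ω =>
    segIntegral (fun u => gammaDeriv α ξ ω u i) 0 (z + Complex.I * ε))
    (fun ε => (measurable_segIntegral_gammaDeriv α hξ_meas i _).aemeasurable) ?_
  filter_upwards [ae_isLift hα hξ_meas hξ_law hξ_indep] with ω ⟨H, hL, _⟩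
  refine (tendsto_comp_vertical (hL.isPrimitive i).continuousOn hz).congr' ?_
  filter_upwards [self_mem_nhdsWithin] with ε hε
  have : 0 < (z + Complex.I * (ε : ℂ)).im := add_mem_openUHP hz hε
  simp only [gamma, if_pos this]

theorem aemeasurable_levyArea {t s : ℂ} (ht : t ∈ closedUHP) (hs : s ∈ closedUHP) :
    AEMeasurable (fun ω => levyArea α ξ ω t s) P := by
  refine aemeasurable_of_tendsto_metrizable_ae (𝓝[>] (0 : ℝ)) (f := fun (ε : ℝ) ω =>
    levyApprox α ξ ε ω t s) (fun ε => (measurable_levyApprox α hξ_meas ε t s).aemeasurable) ?_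
  filter_upwards [ae_isLift hα hξ_meas hξ_law hξ_indep] with ω ⟨H, hL, hA, happ⟩
  rw [hA t ht s hs]
  refine Tendsto.congr' (f₁ := fun ε : ℝ =>
    areaMatrix H (gamma α ξ ω) (t + Complex.I * ε) (s + Complex.I * ε)) ?_ ?_
  · filter_upwards [self_mem_nhdsWithin] with ε hε using (happ ε hε t ht s hs).symm
  · exact tendsto_pi_nhds.2 fun i => tendsto_pi_nhds.2 fun j =>
      tendsto_area (hL.continuousOn i j) (hL.isPrimitive i).continuousOn
        (hL.isPrimitive j).continuousOn ht hs

variable {γ : ℝ} (hγ : γ ∈ Set.Ioo (0 : ℝ) α) {Ω : Set ℂ} (hΩ : Ω ⊆ closedUHP)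

include hγ hΩ

theorem convergesInLp_levyArea (hb : Bornology.IsBounded Ω) {p : ℝ} (hp : 1 ≤ p) :
    ConvergesInLp P p γ Ω (gammaApprox α ξ) (levyApprox α ξ) (gamma α ξ) (levyArea α ξ) := by
  obtain ⟨β, hγβ, hβα⟩ := exists_between hγ.2
  have hγ0 := hγ.1
  have hβ0 : 0 < β := hγ0.trans hγβ
  have hβ2 : β ≤ 1 / 2 := by linarith [hα.2]
  have hp0 : 0 ≤ p := by linarith
  obtain ⟨r₁, hr₁⟩ := hb.subset_closedBall 0
  set r₀ := max r₁ 0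
  have hr₀ : 0 ≤ r₀ := le_max_right _ _
  have hΩr : ∀ z ∈ Ω, ‖z‖ ≤ r₀ := fun z hz =>
    (mem_closedBall_zero_iff.1 (hr₁ hz)).trans (le_max_left _ _)
  have hlift := ae_isLift hα hξ_meas hξ_law hξ_indep
  have hmX : ∀ ε : ℝ, 0 < ε → ∀ t ∈ Ω, AEMeasurable (fun ω => gammaApprox α ξ ε ω t) P :=
    fun ε hε t ht => aemeasurable_gamma hα hξ_meas hξ_law hξ_indep
      (add_mem_closedUHP (hΩ ht) hε.le)
  have hmA : ∀ ε : ℝ, ∀ t ∈ Ω, ∀ s ∈ Ω, AEMeasurable (fun ω => levyApprox α ξ ε ω t s) P :=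
    fun ε t _ s _ => (measurable_levyApprox α hξ_meas ε t s).aemeasurable
  have hmX₀ : ∀ t ∈ Ω, AEMeasurable (fun ω => gamma α ξ ω t) P :=
    fun t ht => aemeasurable_gamma hα hξ_meas hξ_law hξ_indep (hΩ ht)
  have hmA₀ : ∀ t ∈ Ω, ∀ s ∈ Ω, AEMeasurable (fun ω => levyArea α ξ ω t s) P :=
    fun t ht s hs => aemeasurable_levyArea hα hξ_meas hξ_law hξ_indep (hΩ ht) (hΩ hs)
  have hcX : ∀ ε : ℝ, 0 < ε → ∀ᵐ ω ∂P, ContinuousOn (gammaApprox α ξ ε ω) Ω := by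
    intro ε hε
    filter_upwards [hlift] with ω ⟨H, hL, _⟩ using (hL.continuousOn_path_shift hε.le).mono hΩ
  have hcA : ∀ ε : ℝ, 0 < ε →
      ∀ᵐ ω ∂P, ContinuousOn (Function.uncurry (levyApprox α ξ ε ω)) (Ω ×ˢ Ω) := by
    intro ε hε
    filter_upwards [hlift] with ω ⟨H, hL, hA, happ⟩
    exact ((hL.continuousOn_areaMatrix_shift hε.le).mono (Set.prod_mono hΩ hΩ)).congr
      fun q hq => happ ε hε q.1 (hΩ hq.1) q.2 (hΩ hq.2)
  have hdA : ∀ ε : ℝ, 0 < ε → ∀ᵐ ω ∂P, ∀ t ∈ Ω, levyApprox α ξ ε ω t t = 0 := by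
    intro ε hε
    filter_upwards [hlift] with ω ⟨H, hL, hA, happ⟩ t ht
    rw [happ ε hε t (hΩ ht) t (hΩ ht), areaMatrix_self]
  have hcX₀ : ∀ᵐ ω ∂P, ContinuousOn (gamma α ξ ω) Ω := by
    filter_upwards [hlift] with ω ⟨H, hL, _⟩ using hL.continuousOn_path.mono hΩ
  have hcA₀ : ∀ᵐ ω ∂P, ContinuousOn (Function.uncurry (levyArea α ξ ω)) (Ω ×ˢ Ω) := by
    filter_upwards [hlift] with ω ⟨H, hL, hA, happ⟩
    exact (hL.continuousOn_areaMatrix.mono (Set.prod_mono hΩ hΩ)).congr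
      fun q hq => hA q.1 (hΩ hq.1) q.2 (hΩ hq.2)
  have hdA₀ : ∀ᵐ ω ∂P, ∀ t ∈ Ω, levyArea α ξ ω t t = 0 := by
    filter_upwards [hlift] with ω ⟨H, hL, hA, happ⟩ t ht
    rw [hA t (hΩ ht) t (hΩ ht), areaMatrix_self]
  have hmXs : ∀ ε : ℝ, 0 < ε → ∀ t ∈ Ω,
      AEMeasurable (fun ω => (gammaApprox α ξ ε - gamma α ξ) ω t) P := fun ε hε t ht =>
    (hmX ε hε t ht).sub (hmX₀ t ht)
  have hmAs : ∀ ε : ℝ, ∀ t ∈ Ω, ∀ s ∈ Ω,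
      AEMeasurable (fun ω => (levyApprox α ξ ε - levyArea α ξ) ω t s) P := fun ε t ht s hs =>
    (hmA ε t ht s hs).sub (hmA₀ t ht s hs)
  have hcXs : ∀ ε : ℝ, 0 < ε →
      ∀ᵐ ω ∂P, ContinuousOn ((gammaApprox α ξ ε - gamma α ξ) ω) Ω := by
    intro ε hε
    filter_upwards [hcX ε hε, hcX₀] with ω h1 h2 using h1.sub h2
  have hcAs : ∀ ε : ℝ, 0 < ε → ∀ᵐ ω ∂P,
      ContinuousOn (Function.uncurry ((levyApprox α ξ ε - levyArea α ξ) ω)) (Ω ×ˢ Ω) := by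
    intro ε hε
    filter_upwards [hcA ε hε, hcA₀] with ω h1 h2 using h1.sub h2
  have hdAs : ∀ ε : ℝ, 0 < ε →
      ∀ᵐ ω ∂P, ∀ t ∈ Ω, (levyApprox α ξ ε - levyArea α ξ) ω t t = 0 := by
    intro ε hε
    filter_upwards [hdA ε hε, hdA₀] with ω h1 h2 t ht
    simp [h1 t ht, h2 t ht]
  -- One growth constant on a half-disc large enough for the shift by `ε` serves both couples.
  have hbound : ∀ ε : ℝ, 0 < ε → ∃ (N : U → ℝ) (C : ℝ), (∀ ω, 1 ≤ N ω) ∧ 0 ≤ C ∧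
      ∫⁻ ω, ENNReal.ofReal (N ω ^ (2 * p)) ∂P < ∞ ∧
      (∀ᵐ ω ∂P, pairNorm γ Ω (gammaApprox α ξ ε ω) (levyApprox α ξ ε ω) ≤
        ENNReal.ofReal (C * N ω ^ 2)) ∧
      (∀ᵐ ω ∂P, pairNorm γ Ω (gamma α ξ ω) (levyArea α ξ ω) ≤ ENNReal.ofReal (C * N ω ^ 2)) := by
    intro ε hε
    set r := r₀ + ε + 1 with hr
    have hr1 : 1 ≤ r := by linarith
    obtain ⟨N, hN1, hNp, hN⟩ := exists_growthBound (P := P) hα hβα hξ_meas hξ_law hξ_indep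
      (25 * (r + 1)) p hp
    refine ⟨N, 7 * (2 / β + 1) ^ 2 * r, hN1, by positivity, hNp, ?_, ?_⟩
    · filter_upwards [hlift, hN] with ω ⟨H, hL, hA, happ⟩ hNω
      refine le_trans (le_of_eq ?_) (hL.pairNorm_le hγ0 hγβ hβ2 hr1 (hN1 ω) hNω hΩ hε.le
        fun z hz => (hΩr z hz).trans (by linarith))
      exact pairNorm_congr (fun t _ => rfl) fun t ht s hs => happ ε hε t (hΩ ht) s (hΩ hs)
    · filter_upwards [hlift, hN] with ω ⟨H, hL, hA, happ⟩ hNω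
      refine le_trans (le_of_eq ?_) (hL.pairNorm_le hγ0 hγβ hβ2 hr1 (hN1 ω) hNω hΩ le_rfl
        fun z hz => (hΩr z hz).trans (by linarith))
      exact pairNorm_congr (fun t _ => by simp) fun t ht s hs => by
        rw [hA t (hΩ ht) s (hΩ hs)]; simp
  refine ⟨fun ε hε => ?_, ?_, fun ε hε => ?_, ?_⟩
  · obtain ⟨N, C, hN1, hC, hNp, h1, -⟩ := hbound ε hε
    exact inLp_of_le (hmX ε hε) (hmA ε) (hcX ε hε) (hcA ε hε) (hdA ε hε) hN1 hC hp0 hNp h1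
  · obtain ⟨N, C, hN1, hC, hNp, -, h2⟩ := hbound 1 one_pos
    exact inLp_of_le hmX₀ hmA₀ hcX₀ hcA₀ hdA₀ hN1 hC hp0 hNp h2
  · obtain ⟨N, C, hN1, hC, hNp, h1, h2⟩ := hbound ε hε
    refine inLp_of_le (hmXs ε hε) (hmAs ε) (hcXs ε hε) (hcAs ε hε) (hdAs ε hε) hN1
      (add_nonneg hC hC) hp0 hNp ?_
    filter_upwards [h1, h2] with ω e1 e2
    refine (pairNorm_sub_le _ _ _ _ _ _).trans ((add_le_add e1 e2).trans (le_of_eq ?_))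
    rw [← ENNReal.ofReal_add (by positivity) (by positivity), add_mul]
  · set r := r₀ + 1 with hr
    have hr1 : 1 ≤ r := by linarith
    obtain ⟨N, hN1, hNp, hN⟩ := exists_growthBound (P := P) hα hβα hξ_meas hξ_law hξ_indep
      (25 * (r + 1)) p hp
    set C := 13 * (2 / β + 1) ^ 2 * r with hC
    have hC0 : 0 ≤ C := by positivity
    have hle : ∀ ε ∈ Set.Ioo (0 : ℝ) 1,
        ∫⁻ ω, pairNorm γ Ω ((gammaApprox α ξ ε - gamma α ξ) ω)
          ((levyApprox α ξ ε - levyArea α ξ) ω) ^ p ∂P ≤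
        ENNReal.ofReal ((C * ε ^ (β - γ)) ^ p) * ∫⁻ ω, ENNReal.ofReal (N ω ^ (2 * p)) ∂P := by
      intro ε hε
      have hε0 := hε.1
      refine lintegral_rpow_le hN1 (by positivity) hp0 ?_
      filter_upwards [hlift, hN] with ω ⟨H, hL, hA, happ⟩ hNω
      have := hL.pairNorm_sub_le hγ0 hγβ hβ2 hr1 (hN1 ω) hNω hΩ (Set.Ioo_subset_Icc_self hε)
        fun z hz => (hΩr z hz).trans (by linarith)
      refine le_trans (le_of_eq ?_) (this.trans (le_of_eq ?_))
      · exact pairNorm_congr (fun t _ => rfl) fun t ht s hs => by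
          simp only [Pi.sub_apply]
          rw [happ ε hε0 t (hΩ ht) s (hΩ hs), hA t (hΩ ht) s (hΩ hs)]
      · congr 1; ring
    have hlim : Tendsto (fun ε : ℝ => ENNReal.ofReal ((C * ε ^ (β - γ)) ^ p) *
        ∫⁻ ω, ENNReal.ofReal (N ω ^ (2 * p)) ∂P) (𝓝[>] 0) (𝓝 0) := by
      have hβγ : 0 < β - γ := by linarith
      have h1 : Continuous fun ε : ℝ => (C * ε ^ (β - γ)) ^ p :=
        (continuous_const.mul (Real.continuous_rpow_const hβγ.le)).rpow_const fun _ => Or.inr hp0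
      have h2 := ((ENNReal.continuous_ofReal.comp h1).tendsto 0).mono_left
        (nhdsWithin_le_nhds (s := Set.Ioi 0))
      simp only [Function.comp, Real.zero_rpow hβγ.ne', mul_zero,
        Real.zero_rpow (show p ≠ 0 by linarith), ENNReal.ofReal_zero] at h2
      have h3 := ENNReal.Tendsto.mul_const h2 (Or.inr hNp.ne)
      rwa [zero_mul] at h3
    refine tendsto_of_tendsto_of_tendsto_of_le_of_le' tendsto_const_nhds hlim
      (Eventually.of_forall fun _ => zero_le) ?_
    filter_upwards [Ioo_mem_nhdsGT (zero_lt_one (α := ℝ))] with ε hε using hle ε hε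

theorem ae_memHolder_levyArea (hb : Bornology.IsBounded Ω) :
    ∀ᵐ ω ∂P, MemHolder₂ (2 * γ) Ω (levyArea α ξ ω) ∧ MemMulti₂ γ Ω (levyArea α ξ ω) := by
  obtain ⟨β, hγβ, hβα⟩ := exists_between hγ.2
  have hγ0 := hγ.1
  have hβ2 : β ≤ 1 / 2 := by linarith [hα.2]
  obtain ⟨r₁, hr₁⟩ := hb.subset_closedBall 0
  set r := max r₁ 0 + 1 with hr
  have hr1 : 1 ≤ r := by linarith [le_max_right r₁ 0]
  have hΩr : ∀ z ∈ Ω, ‖z‖ ≤ r - 1 := fun z hz =>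
    (mem_closedBall_zero_iff.1 (hr₁ hz)).trans (by linarith [le_max_left r₁ 0])
  obtain ⟨N, hN1, -, hN⟩ := exists_growthBound (P := P) hα hβα hξ_meas hξ_law hξ_indep
      (25 * (r + 1)) 1 le_rfl
  filter_upwards [ae_isLift hα hξ_meas hξ_law hξ_indep, hN] with ω ⟨H, hL, hA, happ⟩ hNω
  have hdiag : ∀ t ∈ Ω, levyArea α ξ ω t t = 0 := fun t ht => by
    rw [hA t (hΩ ht) t (hΩ ht), areaMatrix_self]
  refine ⟨⟨hdiag, ?_⟩, ⟨hdiag, ?_⟩⟩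
  · have h := hL.pairNorm_le hγ0 hγβ hβ2 hr1 (hN1 ω) hNω hΩ le_rfl
      fun z hz => (hΩr z hz).trans (by linarith)
    refine lt_of_le_of_lt ?_ (h.trans_lt ENNReal.ofReal_lt_top)
    refine le_trans (le_of_eq ?_) le_add_self
    exact holderNorm₂_congr fun t ht s hs => by rw [hA t (hΩ ht) s (hΩ hs)]; simp
  · rw [multiNorm₂_congr hΩ hA]
    exact (hL.multiNorm_le hγ0 hγβ hβ2 hr1 (hN1 ω) hNω hΩ hΩr).trans_lt ENNReal.ofReal_lt_top

omit hγ in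
theorem ae_levyArea_relations :
    ∀ᵐ ω ∂P, ∀ i j : Fin d,
      (∀ t ∈ Ω, ∀ u ∈ Ω, ∀ s ∈ Ω, delta₂ (levyArea α ξ ω) t u s i j =
        delta₁ (gamma α ξ ω) t u i * delta₁ (gamma α ξ ω) u s j) ∧
      (∀ t ∈ Ω, ∀ s ∈ Ω, levyArea α ξ ω t s i j + levyArea α ξ ω t s j i =
        delta₁ (gamma α ξ ω) t s i * delta₁ (gamma α ξ ω) t s j) := by
  filter_upwards [ae_isLift hα hξ_meas hξ_law hξ_indep] with ω ⟨H, hL, hA, happ⟩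
  refine fun i j => ⟨fun t ht u hu s hs => ?_, fun t ht s hs => ?_⟩
  · simp only [delta₂, Pi.sub_apply]
    rw [hA t (hΩ ht) s (hΩ hs), hA t (hΩ ht) u (hΩ hu), hA u (hΩ hu) s (hΩ hs)]
    exact area_chen _ _ _ t u s
  · rw [hA t (hΩ ht) s (hΩ hs)]
    exact area_add_area_swap (hL.isPrimitive i) (hL.isPrimitive j) (hL.hasDerivAt i j)
      (hL.continuousOn i j) (hL.hasDerivAt j i) (hL.continuousOn j i) (hΩ ht) (hΩ hs)

end

end AnalyticFBM

theorem mainTheorem2 {U : Type*} [MeasurableSpace U] (P : Measure U) [IsProbabilityMeasure P]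
    (d : ℕ) (α γ : ℝ) (hα : α ∈ Set.Ioo (0 : ℝ) (1 / 2)) (hγ : γ ∈ Set.Ioo (0 : ℝ) α)
    (ξ : Fin d × ℕ × Fin 2 → U → ℝ)
    (hξ_meas : ∀ q, Measurable (ξ q))
    (hξ_law : ∀ q, P.map (ξ q) = gaussianReal 0 1)
    (hξ_indep : iIndepFun ξ P) :
    ∃ A : U → ℂ → ℂ → Fin d → Fin d → ℂ,
      ∀ Ω : Set ℂ, Ω ⊆ AnalyticFBM.closedUHP → Ω ∈ 𝓝[AnalyticFBM.closedUHP] (0 : ℂ) →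
        Bornology.IsBounded Ω →
        (∀ p : ℝ, 1 ≤ p →
          AnalyticFBM.ConvergesInLp P p γ Ω
            (AnalyticFBM.gammaApprox α ξ) (AnalyticFBM.levyApprox α ξ)
            (AnalyticFBM.gamma α ξ) A) ∧
        (∀ᵐ ω ∂P, AnalyticFBM.MemHolder₂ (2 * γ) Ω (A ω) ∧
          AnalyticFBM.MemMulti₂ γ Ω (A ω)) ∧
        (∀ᵐ ω ∂P, ∀ i j : Fin d,
          (∀ t ∈ Ω, ∀ u ∈ Ω, ∀ s ∈ Ω,
            AnalyticFBM.delta₂ (A ω) t u s i j =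
              AnalyticFBM.delta₁ (AnalyticFBM.gamma α ξ ω) t u i *
                AnalyticFBM.delta₁ (AnalyticFBM.gamma α ξ ω) u s j) ∧
          (∀ t ∈ Ω, ∀ s ∈ Ω,
            A ω t s i j + A ω t s j i =
              AnalyticFBM.delta₁ (AnalyticFBM.gamma α ξ ω) t s i *
                AnalyticFBM.delta₁ (AnalyticFBM.gamma α ξ ω) t s j)) :=
  ⟨AnalyticFBM.levyArea α ξ, fun _ hΩ _ hb =>
    ⟨fun _ hp => AnalyticFBM.convergesInLp_levyArea hα hξ_meas hξ_law hξ_indep hγ hΩ hb hp,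
      AnalyticFBM.ae_memHolder_levyArea hα hξ_meas hξ_law hξ_indep hγ hΩ hb,
      AnalyticFBM.ae_levyArea_relations hα hξ_meas hξ_law hξ_indep hΩ⟩⟩
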